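/- Let $\mathfrak g$ be a finite-dimensional complex semisimple Lie algebra with Killing form $\langle\cdot,\cdot\rangle$, and let $\mathfrak h\subseteq\mathfrak g$ be a reductive Lie subalgebra containing a Cartan subalgebra $\mathfrak t$ of $\mathfrak g$. Let $\mathfrak q=\mathfrak h^{\perp}$ be the orthogonal complement with respect to the Killing form, and let $C(\mathfrak q)$ be its Clifford algebra, the quotient of the tensor algebra of $\mathfrak q$ by the relations $XY+YX=\langle X,Y\rangle$. Let $S$ be an irreducible $C(\mathfrak q)$-module (a space of spinors), viewed as a representation of $\mathfrak h$ (the spin representation) through the homomorphism $\mathfrak h\xrightarrow{\mathrm{ad}}\mathfrak{so}(\mathfrak q)\to C(\mathfrak q)$, $Y\mapsto\frac12\sum_i[Y,e_i]\,\tilde e_i$, where $(e_i)$ and $(\tilde e_i)$ are dual bases of $\mathfrak q$. Let $\Delta$ be the set of roots of $(\mathfrak g,\mathfrak t)$ with Weyl group $W$, let $\Delta^+$ be a positive system, let $\Delta_{\mathfrak h}^+$ be the set of the roots in $\Delta^+$ whose root space lies in $\mathfrak h$, and let $\rho$ and $\rho_{\mathfrak h}$ be the half-sums of the elements of $\Delta^+$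 and of $\Delta^+_{\mathfrak h}$. Write $\langle\cdot,\cdot\rangle$ also for the bilinear form induced on $\mathfrak t^*$ and $\lVert x\rVert^2=\langle x,x\rangle$. Let $V$ be a finite-dimensional irreducible representation of $\mathfrak g$ of highest weight $\lambda$; its extremal weights are the elements of $W\lambda$. Let $\mu\in\mathfrak t^*$ be a weight of the $\mathfrak h$-representation $V\otimes S$, and let $\mu_1\in\mathfrak t^*$ be related to $\mu$, that is, $\mu_1$ is a weight of $S$ and $\mu-\mu_1$ is a weight of $V$. Then $$\lVert\lambda+\rho\rVert^2-\lVert\mu+\rho_{\mathfrak h}\rVert^2\;\ge\;\lVert\rho\rVert^2-\lVert\mu_1+\rho_{\mathfrak h}\rVert^2 .$$ Moreover, there is $w\in W$ such that $w(\mu-\mu_1)$ is $\Delta^+$-dominant, and for every such $w$: equality holds if and only if $\mu-\mu_1$ is an extremal weight of $V$ and $\rho-w(\mu_1+\rho_{\mathfrak h})$ is orthogonal to $\lambda$; and in case of equality there is a subset $A\subseteq\Delta^+$ with $\rho-w(\mu_1+\rho_{\mathfrak h})=\sum_{\alpha\in A}\alpha$ and $\langle\alpha,\lambda\rangle=0$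 for every $\alpha\in A$. -/

import Mathlib

open scoped TensorProduct ComplexOrder

noncomputable section

namespace DiracPair

/-! ### The orthogonal complement of a subalgebra and its Clifford algebra -/

section Clifford

variable {g : Type*} [LieRing g] [LieAlgebra ℂ g]

/-- The orthogonal complement `q` of the subalgebra `h` of `g` with respect to the Killing form
of `g`. -/
def complement (h : LieSubalgebra ℂ g) : Submodule ℂ g :=
  LinearMap.BilinForm.orthogonal (killingForm ℂ g) h.toSubmodule

/-- The restriction to `q` of the Killing form of `g`. -/
def complementForm (h : LieSubalgebra ℂ g) : LinearMap.BilinForm ℂ (complement h) :=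
  LinearMap.BilinForm.restrict (killingForm ℂ g) (complement h)

/-- The quadratic form `X ↦ ⟨X, X⟩ / 2` on `q`. -/
def cliffordForm (h : LieSubalgebra ℂ g) : QuadraticForm ℂ (complement h) :=
  (1 / 2 : ℂ) • LinearMap.BilinMap.toQuadraticMap (complementForm h)

theorem complementForm_apply (h : LieSubalgebra ℂ g) (x y : complement h) :
    complementForm h x y = killingForm ℂ g x y := rfl

theorem complementForm_isSymm (h : LieSubalgebra ℂ g) : (complementForm h).IsSymm :=
  ⟨fun x y => LieModule.traceForm_comm ℂ g g (x : g) (y : g)⟩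

/-- The Clifford algebra of `cliffordForm h` is the quotient of the tensor algebra of `q` by the
relations `X ⊗ Y + Y ⊗ X = ⟨X, Y⟩`. -/
theorem ι_mul_ι_add_swap (h : LieSubalgebra ℂ g) (x y : complement h) :
    CliffordAlgebra.ι (cliffordForm h) x * CliffordAlgebra.ι (cliffordForm h) y +
      CliffordAlgebra.ι (cliffordForm h) y * CliffordAlgebra.ι (cliffordForm h) x =
      algebraMap ℂ _ (complementForm h x y) := by
  rw [CliffordAlgebra.ι_mul_ι_add_swap]
  congr 1
  have hs : complementForm h y x = complementForm h x y := (complementForm_isSymm h).eq y x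
  simp only [QuadraticMap.polar, cliffordForm, smul_apply,
    LinearMap.BilinMap.toQuadraticMap_apply, map_add, LinearMap.add_apply, smul_eq_mul, hs]
  ring

theorem lie_mem_complement (h : LieSubalgebra ℂ g) (Y : h) {x : g} (hx : x ∈ complement h) :
    ⁅(Y : g), x⁆ ∈ complement h := by
  intro z hz
  have h1 : killingForm ℂ g ⁅z, (Y : g)⁆ x = 0 := hx _ (h.lie_mem hz Y.2)
  change killingForm ℂ g z ⁅(Y : g), x⁆ = 0
  rw [← LieModule.traceForm_apply_lie_apply]
  exact h1

/-- The adjoint action of `h` on `q`. -/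
def adComplement (h : LieSubalgebra ℂ g) : h →ₗ[ℂ] Module.End ℂ (complement h) where
  toFun Y := ((LieAlgebra.ad ℂ g (Y : g) : Module.End ℂ g)).restrict
    (fun _ hx => lie_mem_complement h Y hx)
  map_add' Y Z := by
    ext x
    exact add_lie (Y : g) (Z : g) (x : g)
  map_smul' c Y := by
    ext x
    exact smul_lie c (Y : g) (x : g)

theorem coe_adComplement_apply (h : LieSubalgebra ℂ g) (Y : h) (x : complement h) :
    (adComplement h Y x : g) = ⁅(Y : g), (x : g)⁆ := rfl

theorem complementForm_adComplement (h : LieSubalgebra ℂ g) (Y : h) (x y : complement h) :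
    complementForm h (adComplement h Y x) y = -complementForm h x (adComplement h Y y) := by
  rw [complementForm_apply, complementForm_apply, coe_adComplement_apply, coe_adComplement_apply,
    ← LieModule.traceForm_apply_lie_apply, ← lie_skew, map_neg, LinearMap.neg_apply]

end Clifford

/-! ### The Killing form is nondegenerate on the complement -/

section Nondegenerate

variable {g : Type*} [LieRing g] [LieAlgebra ℂ g] [FiniteDimensional ℂ g]

/-- The ideal of the elements of `h` that are orthogonal to `h`. -/
def killingKernel (h : LieSubalgebra ℂ g) : LieIdeal ℂ h where
  carrier := {x | ∀ y : h, killingForm ℂ g (x : g) (y : g) = 0}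
  add_mem' := by
    intro x y hx hy z
    simp [hx z, hy z]
  zero_mem' := by intro z; simp
  smul_mem' := by
    intro c x hx z
    simp [hx z]
  lie_mem := by
    intro z x hx y
    have := hx ⁅y, z⁆
    rw [LieSubalgebra.coe_bracket, ← lie_skew, map_neg, LinearMap.neg_apply,
      LieModule.traceForm_apply_lie_apply, ← lie_skew, map_neg, neg_neg]
    exact this

theorem killingKernel_isSolvable (h : LieSubalgebra ℂ g) :
    LieAlgebra.IsSolvable (killingKernel h) := by
  have tf : LieModule.traceForm ℂ (killingKernel h) g = 0 := by
    ext x y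
    exact x.2 (y : h)
  have nilp : LieModule.IsNilpotent (LieAlgebra.derivedSeries ℂ (killingKernel h) 1) g :=
    LieModule.isNilpotent_derivedSeries_of_traceForm_eq_zero tf
  have ring_nilp : LieRing.IsNilpotent (LieAlgebra.derivedSeries ℂ (killingKernel h) 1) := by
    rw [LieAlgebra.isNilpotent_iff_forall (R := ℂ)]
    intro x
    apply LieSubalgebra.isNilpotent_ad_of_isNilpotent_ad
      (LieAlgebra.derivedSeries ℂ (killingKernel h) 1 : LieSubalgebra ℂ (killingKernel h)) (x := x)
    apply LieSubalgebra.isNilpotent_ad_of_isNilpotent_ad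
      (killingKernel h : LieSubalgebra ℂ h) (x := (x : killingKernel h))
    apply LieSubalgebra.isNilpotent_ad_of_isNilpotent_ad h (x := ((x : killingKernel h) : h))
    exact (LieModule.isNilpotent_iff_forall' (R := ℂ)).mp nilp x
  have hsol : LieAlgebra.IsSolvable (LieAlgebra.derivedSeries ℂ (killingKernel h) 1) :=
    inferInstance
  obtain ⟨k, hk⟩ := LieAlgebra.IsSolvable.solvable ℂ
    (LieAlgebra.derivedSeries ℂ (killingKernel h) 1)
  rw [LieIdeal.derivedSeries_eq_bot_iff] at hk
  refine LieAlgebra.IsSolvable.mk (R := ℂ) (k := k + 1) ?_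
  rwa [LieAlgebra.derivedSeries_def, LieAlgebra.derivedSeriesOfIdeal_add]

/-- If `h` is reductive and contains a Cartan subalgebra of the semisimple Lie algebra `g`, then
the Killing form of `g` is nondegenerate on the orthogonal complement of `h`. -/
theorem complementForm_nondegenerate [LieAlgebra.IsSemisimple ℂ g] (h t : LieSubalgebra ℂ g)
    [LieAlgebra.HasCentralRadical ℂ h] [t.IsCartanSubalgebra] (ht : t ≤ h) :
    (complementForm h).Nondegenerate := by
  have hrefl : (killingForm ℂ g).IsRefl := (LieModule.traceForm_isSymm ℂ g g).isRefl
  have hnd : (killingForm ℂ g).Nondegenerate := LieAlgebra.IsKilling.killingForm_nondegenerate ℂ g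
  have hker : ∀ x : h, x ∈ killingKernel h → x = 0 := by
    intro x hx
    have hle : killingKernel h ≤ LieAlgebra.center ℂ h := by
      rw [← LieAlgebra.HasCentralRadical.radical_eq_center]
      have := killingKernel_isSolvable h
      exact (LieAlgebra.LieIdeal.solvable_iff_le_radical ℂ h _).mp this
    have hc : ∀ y : h, ⁅y, x⁆ = 0 := hle hx
    have hxt : (x : g) ∈ t := by
      rw [← LieSubalgebra.IsCartanSubalgebra.self_normalizing (H := t),
        LieSubalgebra.mem_normalizer_iff]
      intro y hy
      have h0 : ⁅y, (x : g)⁆ = 0 := congrArg Subtype.val (hc ⟨y, ht hy⟩)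
      rw [← lie_skew, h0, neg_zero]
      exact t.zero_mem
    have hz : (⟨x, hxt⟩ : t) = 0 := by
      refine (LieAlgebra.IsKilling.traceForm_cartan_nondegenerate ℂ g t).1 _ fun y => ?_
      exact hx ⟨y, ht y.2⟩
    exact Subtype.ext (congrArg (fun z : t => (z : g)) hz)
  refine LinearMap.BilinForm.nondegenerate_restrict_of_disjoint_orthogonal _ hrefl ?_
  rw [complement, LinearMap.BilinForm.orthogonal_orthogonal hnd hrefl, Submodule.disjoint_def]
  intro x hxq hxh
  exact congrArg (fun z : h => (z : g))
    (hker ⟨x, hxh⟩ fun y => hrefl _ _ (hxq (y : g) y.2))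

end Nondegenerate

/-! ### The spin representation and weights -/

section Spin

variable {g : Type*} [LieRing g] [LieAlgebra ℂ g] [FiniteDimensional ℂ g]

/-- The map `h → so(q) → C(q)`: the element `Y` is sent to `(1 / 2) ∑ᵢ [Y, eᵢ] ẽᵢ`, where `(eᵢ)` and
`(ẽᵢ)` are dual bases of `q`. -/
def spinMap (h : LieSubalgebra ℂ g) (hB : (complementForm h).Nondegenerate) :
    h →ₗ[ℂ] CliffordAlgebra (cliffordForm h) :=
  (1 / 2 : ℂ) • ∑ i,
    (LinearMap.mulRight ℂ (CliffordAlgebra.ι (cliffordForm h)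
        ((complementForm h).dualBasis hB (Module.finBasis ℂ (complement h)) i))) ∘ₗ
      CliffordAlgebra.ι (cliffordForm h) ∘ₗ
      (LinearMap.applyₗ (Module.finBasis ℂ (complement h) i)) ∘ₗ adComplement h

theorem spinMap_apply (h : LieSubalgebra ℂ g) (hB : (complementForm h).Nondegenerate) (Y : h) :
    spinMap h hB Y = (1 / 2 : ℂ) • ∑ i,
      CliffordAlgebra.ι (cliffordForm h)
          (adComplement h Y (Module.finBasis ℂ (complement h) i)) *
        CliffordAlgebra.ι (cliffordForm h)
          ((complementForm h).dualBasis hB (Module.finBasis ℂ (complement h)) i) := by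
  simp [spinMap]

/-- The element `spinMap h hB Y` of `C(q)` acts on `q` by commutators as `Y` does. -/
theorem spinMap_commutator (h : LieSubalgebra ℂ g) (hB : (complementForm h).Nondegenerate)
    (Y : h) (x : complement h) :
    spinMap h hB Y * CliffordAlgebra.ι (cliffordForm h) x -
      CliffordAlgebra.ι (cliffordForm h) x * spinMap h hB Y =
      CliffordAlgebra.ι (cliffordForm h) (adComplement h Y x) := by
  set e := Module.finBasis ℂ (complement h) with he
  set e' := (complementForm h).dualBasis hB e with he'
  set κ := CliffordAlgebra.ι (cliffordForm h) with hκ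
  have hsymm := complementForm_isSymm h
  have hs : ∀ a c, complementForm h a c = complementForm h c a := fun a c => hsymm.eq a c
  have h1 : ∀ z, ∑ i, complementForm h (e i) z • e' i = z := by
    intro z
    conv_rhs => rw [← e'.sum_repr z]
    refine Finset.sum_congr rfl fun i _ => ?_
    rw [he', LinearMap.BilinForm.dualBasis_repr_apply, hs]
  have h2 : ∀ z, ∑ i, complementForm h (e' i) z • e i = z := by
    intro z
    have hdd : (complementForm h).dualBasis hB e' = e :=
      LinearMap.BilinForm.dualBasis_dualBasis hB hsymm e
    conv_rhs => rw [← e.sum_repr z]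
    refine Finset.sum_congr rfl fun i _ => ?_
    conv_rhs => rw [← hdd]
    rw [LinearMap.BilinForm.dualBasis_repr_apply, hs, hdd]
  have key : ∀ a c : complement h, κ a * κ c * κ x - κ x * (κ a * κ c) =
      κ (complementForm h c x • a) - κ (complementForm h a x • c) := by
    intro a c
    have hc := ι_mul_ι_add_swap h c x
    have ha := ι_mul_ι_add_swap h a x
    rw [← hκ] at hc ha
    rw [map_smul, map_smul, Algebra.smul_def, Algebra.smul_def, ← hc, ← ha]
    have hcomm : (κ c * κ x + κ x * κ c) * κ a = κ a * (κ c * κ x + κ x * κ c) := by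
      rw [hc]; exact Algebra.commutes _ _
    rw [hcomm]
    noncomm_ring
  rw [spinMap_apply, ← he, ← he', ← hκ, smul_mul_assoc, mul_smul_comm, ← smul_sub, Finset.sum_mul,
    Finset.mul_sum, ← Finset.sum_sub_distrib]
  simp_rw [key]
  rw [Finset.sum_sub_distrib, ← map_sum, ← map_sum, ← map_sub]
  have h3 : ∑ i, complementForm h (e' i) x • adComplement h Y (e i) = adComplement h Y x := by
    conv_rhs => rw [← h2 x]
    simp [map_sum]
  have h4 : ∑ i, complementForm h (adComplement h Y (e i)) x • e' i = -adComplement h Y x := by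
    conv_rhs => rw [← h1 (adComplement h Y x)]
    simp_rw [complementForm_adComplement, neg_smul, Finset.sum_neg_distrib]
  rw [h3, h4, sub_neg_eq_add, ← two_smul ℂ, map_smul, smul_smul]
  norm_num

/-- `spinMap h hB` is a homomorphism of Lie algebras for the commutator of `C(q)`. -/
theorem spinMap_lie (h : LieSubalgebra ℂ g) (hB : (complementForm h).Nondegenerate) (Y Z : h) :
    spinMap h hB ⁅Y, Z⁆ =
      spinMap h hB Y * spinMap h hB Z - spinMap h hB Z * spinMap h hB Y := by
  set e := Module.finBasis ℂ (complement h) with he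
  set e' := (complementForm h).dualBasis hB e with he'
  set κ := CliffordAlgebra.ι (cliffordForm h) with hκ
  have hsymm := complementForm_isSymm h
  have hs : ∀ a c, complementForm h a c = complementForm h c a := fun a c => hsymm.eq a c
  have h1 : ∀ z, ∑ i, complementForm h (e i) z • e' i = z := by
    intro z
    conv_rhs => rw [← e'.sum_repr z]
    refine Finset.sum_congr rfl fun i _ => ?_
    rw [he', LinearMap.BilinForm.dualBasis_repr_apply, hs]
  have h2 : ∀ z, ∑ i, complementForm h (e' i) z • e i = z := by
    intro z
    have hdd : (complementForm h).dualBasis hB e' = e :=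
      LinearMap.BilinForm.dualBasis_dualBasis hB hsymm e
    conv_rhs => rw [← e.sum_repr z]
    refine Finset.sum_congr rfl fun i _ => ?_
    conv_rhs => rw [← hdd]
    rw [LinearMap.BilinForm.dualBasis_repr_apply, hs, hdd]
  have hswap : ∑ i, κ (adComplement h Z (e i)) * κ (adComplement h Y (e' i)) =
      -∑ i, κ (adComplement h Z (adComplement h Y (e i))) * κ (e' i) := by
    have hl : ∀ i, κ (adComplement h Z (e i)) * κ (adComplement h Y (e' i)) =
        ∑ j, complementForm h (e j) (adComplement h Y (e' i)) •
          (κ (adComplement h Z (e i)) * κ (e' j)) := by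
      intro i
      conv_lhs => rw [← h1 (adComplement h Y (e' i))]
      simp only [map_sum, map_smul, Finset.mul_sum, mul_smul_comm]
    have hr : ∀ j, κ (adComplement h Z (adComplement h Y (e j))) * κ (e' j) =
        ∑ i, complementForm h (e' i) (adComplement h Y (e j)) •
          (κ (adComplement h Z (e i)) * κ (e' j)) := by
      intro j
      conv_lhs => rw [← h2 (adComplement h Y (e j))]
      simp only [map_sum, map_smul, Finset.sum_mul, smul_mul_assoc]
    rw [Finset.sum_congr rfl fun i _ => hl i, Finset.sum_congr rfl fun i _ => hr i,
      Finset.sum_comm, ← Finset.sum_neg_distrib]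
    refine Finset.sum_congr rfl fun j _ => ?_
    rw [← Finset.sum_neg_distrib]
    refine Finset.sum_congr rfl fun i _ => ?_
    rw [← neg_smul, ← complementForm_adComplement, hs]
  have hbr : ∀ x, adComplement h ⁅Y, Z⁆ x =
      adComplement h Y (adComplement h Z x) - adComplement h Z (adComplement h Y x) := by
    intro x
    apply Subtype.ext
    exact lie_lie (Y : g) (Z : g) (x : g)
  have hcomm : ∀ x, spinMap h hB Y * κ x = κ (adComplement h Y x) + κ x * spinMap h hB Y := by
    intro x
    rw [← spinMap_commutator h hB Y x, hκ, sub_add_cancel]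
  have hterm : ∀ i, spinMap h hB Y * (κ (adComplement h Z (e i)) * κ (e' i)) -
      κ (adComplement h Z (e i)) * κ (e' i) * spinMap h hB Y =
      κ (adComplement h Y (adComplement h Z (e i))) * κ (e' i) +
        κ (adComplement h Z (e i)) * κ (adComplement h Y (e' i)) := by
    intro i
    rw [← mul_assoc, hcomm, add_mul, mul_assoc _ (spinMap h hB Y), hcomm]
    noncomm_ring
  rw [spinMap_apply h hB ⁅Y, Z⁆, spinMap_apply h hB Z, ← he, ← he', ← hκ, mul_smul_comm,
    smul_mul_assoc, ← smul_sub, Finset.mul_sum, Finset.sum_mul, ← Finset.sum_sub_distrib,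
    Finset.sum_congr rfl fun i _ => hterm i, Finset.sum_add_distrib, hswap]
  simp_rw [hbr, map_sub, sub_mul, Finset.sum_sub_distrib]
  rw [sub_eq_add_neg]

/-- The spin representation of `h` on a module `S` over the Clifford algebra of `q`. -/
def spinAction (h : LieSubalgebra ℂ g) (hB : (complementForm h).Nondegenerate)
    (S : Type*) [AddCommGroup S] [Module ℂ S] [Module (CliffordAlgebra (cliffordForm h)) S]
    [IsScalarTower ℂ (CliffordAlgebra (cliffordForm h)) S] : h →ₗ[ℂ] Module.End ℂ S :=
  (Algebra.lsmul ℂ ℂ S : CliffordAlgebra (cliffordForm h) →ₐ[ℂ] Module.End ℂ S).toLinearMap ∘ₗ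
    spinMap h hB

/-- The restriction to `h` of the representation of `g` on `V`. -/
def restrictAction (h : LieSubalgebra ℂ g) (V : Type*) [AddCommGroup V] [Module ℂ V]
    [LieRingModule g V] [LieModule ℂ g V] : h →ₗ[ℂ] Module.End ℂ V :=
  (LieModule.toEnd ℂ g V : g →ₗ[ℂ] Module.End ℂ V) ∘ₗ h.toSubmodule.subtype

/-- The diagonal action `Y ↦ Y ⊗ 1 + 1 ⊗ Y` on the tensor product of two representations. -/
def tensorAction {h : LieSubalgebra ℂ g} {V S : Type*} [AddCommGroup V] [Module ℂ V]
    [AddCommGroup S] [Module ℂ S] (σ : h →ₗ[ℂ] Module.End ℂ V) (τ : h →ₗ[ℂ] Module.End ℂ S) :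
    h →ₗ[ℂ] Module.End ℂ (V ⊗[ℂ] S) :=
  LinearMap.rTensorHom S ∘ₗ σ + LinearMap.lTensorHom V ∘ₗ τ

/-- `μ` is a weight, with respect to the subalgebra `t` of `h`, of a representation `σ` of `h`. -/
def IsWeight {h t : LieSubalgebra ℂ g} (ht : t ≤ h) {M : Type*} [AddCommGroup M] [Module ℂ M]
    (σ : h →ₗ[ℂ] Module.End ℂ M) (μ : Module.Dual ℂ t) : Prop :=
  ∃ m : M, m ≠ 0 ∧ ∀ H : t, σ ⟨H, ht H.2⟩ m = μ H • m

/-- `μ₁` is a weight of the representation `τ` related to `μ`: moreover `μ - μ₁` is a weight of the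
representation `σ`. -/
def IsRelated {h t : LieSubalgebra ℂ g} (ht : t ≤ h) {V S : Type*} [AddCommGroup V] [Module ℂ V]
    [AddCommGroup S] [Module ℂ S] (σ : h →ₗ[ℂ] Module.End ℂ V) (τ : h →ₗ[ℂ] Module.End ℂ S)
    (μ μ₁ : Module.Dual ℂ t) : Prop :=
  IsWeight ht τ μ₁ ∧ IsWeight ht σ (μ - μ₁)

end Spin

/-! ### Roots, the form on the dual of the Cartan subalgebra, and highest weights -/

section Roots

open LieAlgebra.IsKilling

variable {g : Type*} [LieRing g] [LieAlgebra ℂ g] [FiniteDimensional ℂ g]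
  [LieAlgebra.IsSemisimple ℂ g] {t : LieSubalgebra ℂ g} [t.IsCartanSubalgebra]

/-- The bilinear form `⟨·, ·⟩` induced on `t*` by the Killing form. -/
def form (x y : Module.Dual ℂ t) : ℂ :=
  killingForm ℂ g ((cartanEquivDual t).symm x : g) ((cartanEquivDual t).symm y : g)

/-- `‖x‖² = ⟨x, x⟩`. This is a nonnegative real number when `x` is a real combination of roots. -/
def normSq (x : Module.Dual ℂ t) : ℂ := form x x

open Classical in
/-- The positive system `Δ⁺` with base `b`. -/
def posRoots (b : (rootSystem t).Base) : Finset t.root :=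
  Finset.univ.filter fun α => b.IsPos α

/-- Half the sum of the positive roots. -/
def rho (b : (rootSystem t).Base) : Module.Dual ℂ t :=
  (1 / 2 : ℂ) • ∑ α ∈ posRoots b, (rootSystem t).root α

open Classical in
/-- The positive system `Δ⁺ ∩ Δ_h`: the positive roots of `g` whose root space lies in `h`. -/
def posRootsSub (b : (rootSystem t).Base) (h : LieSubalgebra ℂ g) : Finset t.root :=
  (posRoots b).filter fun α =>
    (LieAlgebra.rootSpace t (α : LieModule.Weight ℂ t g)).toSubmodule ≤ h.toSubmodule

/-- Half the sum of the positive roots of `h`. -/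
def rhoSub (b : (rootSystem t).Base) (h : LieSubalgebra ℂ g) : Module.Dual ℂ t :=
  (1 / 2 : ℂ) • ∑ α ∈ posRootsSub b h, (rootSystem t).root α

/-- `x` is `Δ⁺`-dominant: `⟨x, α⟩` is a nonnegative real number for every positive root `α`. -/
def IsDominant (b : (rootSystem t).Base) (x : Module.Dual ℂ t) : Prop :=
  ∀ α ∈ posRoots b, 0 ≤ form x ((rootSystem t).root α)

/-- `lam` is the weight of a nonzero vector of `V` which is killed by every positive root space. -/
def IsHighestWeight (b : (rootSystem t).Base) (V : Type*) [AddCommGroup V] [Module ℂ V]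
    [LieRingModule g V] (lam : Module.Dual ℂ t) : Prop :=
  ∃ v : V, v ≠ 0 ∧ (∀ H : t, ⁅(H : g), v⁆ = lam H • v) ∧
    ∀ α ∈ posRoots b, ∀ x ∈ LieAlgebra.rootSpace t (α : LieModule.Weight ℂ t g), ⁅x, v⁆ = 0

/-- `ν` is an extremal weight of the irreducible representation of highest weight `lam`, that is, a
conjugate of `lam` under the Weyl group. -/
def IsExtremal (lam ν : Module.Dual ℂ t) : Prop :=
  ∃ w : (rootSystem t).weylGroup, ν = w • lam

end Roots

end DiracPair

end

/-! Put `ν = μ - μ₁`, a weight of `V`, and `κ = μ₁ + ρ_h`, so that `μ + ρ_h = ν + κ`. Two facts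
about `κ` and `ν` give everything.

The first concerns spinors. Up to sign, a root vector and its opposite in `q` give a commuting
family of idempotents `P α` in the Clifford algebra, one for each positive root outside `h`, and `H
∈ t` acts on `S` as `(1/2) ∑ α(H) (2 P α - 1)`. Hence `μ₁` is half a sum of these roots with signs,
and `κ` is half the sum of a choice of one root from each pair `±α` (`exists_spin_weight_eq`). The
Weyl group permutes such choices, so `w κ = ρ - ∑_{α ∈ A} α` with `A ⊆ Δ⁺` for every `w`
(`IsSignedHalfSum.smul`, `IsSignedHalfSum.exists_eq_rho_sub`).

The second is the classical theory of weights: `ν` is integral, some conjugate `w ν` is dominant, `w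
ν` is again a weight, and `λ - w ν` is a sum of positive roots (`IsIntegral.exists_isDominant`,
`HasWeight.smul`, `IsHighestWeight.sub_mem_posCone`).

With `σ = ρ - w κ`, invariance of the form gives (`normSq_diff_eq`) that the left side minus the
right side of the inequality is `‖λ - wν‖² + 2⟨wν, λ - wν⟩ + 2⟨ρ, λ - wν⟩ + 2⟨wν, σ⟩`. Each term is
nonnegative: the first because the form is positive on integral elements, the others because `wν`
and `ρ` are dominant while `λ - wν` and `σ` are sums of positive roots. Equality forces every term
to vanish, that is, `λ = wν` and `⟨λ, σ⟩ = 0`; the latter is a vanishing sum of nonnegative numbers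
`⟨λ, α⟩` over `α ∈ A`.

Inequalities are in the order of `ℂ`, where `0 ≤ z` also says that `z` is real; positivity therefore
carries reality with it. -/

noncomputable section

namespace DiracPair

open LieAlgebra.IsKilling RootPairing

/-! ### The form on `t*` and its positivity on integral elements. -/

section RootForm

variable {g : Type*} [LieRing g] [LieAlgebra ℂ g] [FiniteDimensional ℂ g]
  [LieAlgebra.IsSemisimple ℂ g] {t : LieSubalgebra ℂ g} [t.IsCartanSubalgebra]

/-- `form` as a bilinear form. -/
def formBilin : LinearMap.BilinForm ℂ (Module.Dual ℂ t) :=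
  (LieModule.traceForm ℂ t g).compl₁₂ (cartanEquivDual t).symm.toLinearMap
    (cartanEquivDual t).symm.toLinearMap

theorem form_eq_formBilin (x y : Module.Dual ℂ t) : form x y = formBilin x y := rfl

theorem form_eq_apply (x y : Module.Dual ℂ t) : form x y = x ((cartanEquivDual t).symm y) := by
  conv_rhs => rw [← (cartanEquivDual t).apply_symm_apply x]
  rfl

theorem form_comm (x y : Module.Dual ℂ t) : form x y = form y x :=
  LieModule.traceForm_comm ℂ g g _ _

theorem form_add_left (x y z : Module.Dual ℂ t) : form (x + y) z = form x z + form y z := by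
  simp [form_eq_formBilin]

theorem form_add_right (x y z : Module.Dual ℂ t) : form x (y + z) = form x y + form x z := by
  simp [form_eq_formBilin]

theorem form_sub_left (x y z : Module.Dual ℂ t) : form (x - y) z = form x z - form y z := by
  simp [form_eq_formBilin]

theorem form_sub_right (x y z : Module.Dual ℂ t) : form x (y - z) = form x y - form x z := by
  simp [form_eq_formBilin]

theorem form_smul_left (c : ℂ) (x z : Module.Dual ℂ t) : form (c • x) z = c * form x z := by
  simp [form_eq_formBilin]

theorem form_smul_right (c : ℂ) (x z : Module.Dual ℂ t) : form x (c • z) = c * form x z := by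
  simp [form_eq_formBilin]

theorem form_sum_right {κ : Type*} (s : Finset κ) (f : κ → Module.Dual ℂ t)
    (x : Module.Dual ℂ t) : form x (∑ i ∈ s, f i) = ∑ i ∈ s, form x (f i) := by
  simp [form_eq_formBilin]

theorem form_zero_left (x : Module.Dual ℂ t) : form 0 x = 0 := by
  simp [form_eq_formBilin]

/-- The Killing form on `t` is the trace of `ad H ∘ ad H'`, and each root contributes `β(H) β(H')`.
Writing the form as a sum of products is what makes positivity accessible. -/
theorem form_eq_sum_roots (x y : Module.Dual ℂ t) :
    form x y = ∑ β : t.root, form x ((rootSystem t).root β) * form y ((rootSystem t).root β) := by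
  have h := congrArg (fun B : LinearMap.BilinForm ℂ t =>
    B ((cartanEquivDual t).symm x) ((cartanEquivDual t).symm y))
    (restrict_killingForm_eq_sum (K := ℂ) (L := g) (H := t))
  refine h.trans ?_
  simp only [LinearMap.sum_apply]
  rw [← Finset.sum_coe_sort]
  refine Finset.sum_congr rfl fun β _ => ?_
  rw [form_comm x, form_comm y, form_eq_apply, form_eq_apply]
  simp

theorem form_root_self_ne_zero (α : t.root) :
    form ((rootSystem t).root α) ((rootSystem t).root α) ≠ 0 := by
  rw [form_eq_apply]
  exact root_apply_cartanEquivDual_symm_ne_zero (LieSubalgebra.isNonZero_coe_root α)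

/-- The coroot is the dual of `α` rescaled by `2 / ⟨α, α⟩`. This trades pairings with roots for
values on coroots, which are integers for weights. -/
theorem form_root_right (x : Module.Dual ℂ t) (α : t.root) :
    form x ((rootSystem t).root α) =
      x ((rootSystem t).coroot α) *
        (form ((rootSystem t).root α) ((rootSystem t).root α) / 2) := by
  have h0 := form_root_self_ne_zero α
  rw [form_eq_apply] at h0
  rw [form_eq_apply, form_eq_apply, rootSystem_coroot_apply, LieAlgebra.IsKilling.coroot]
  simp only [map_nsmul, map_smul, rootSystem_root_apply] at h0 ⊢
  set c := ((α : LieModule.Weight ℂ t g) : Module.Dual ℂ t)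
    ((cartanEquivDual t).symm (α : LieModule.Weight ℂ t g)) with hc
  have hc' : (α : LieModule.Weight ℂ t g)
    ((cartanEquivDual t).symm (α : LieModule.Weight ℂ t g)) = c := rfl
  simp only [hc', nsmul_eq_mul, smul_eq_mul]
  field_simp
  norm_num

theorem root_apply_coroot_eq_intCast (α β : t.root) :
    ∃ n : ℤ, (rootSystem t).root β ((rootSystem t).coroot α) = n :=
  ⟨_, apply_coroot_eq_cast (α : LieModule.Weight ℂ t g) (β : LieModule.Weight ℂ t g)⟩

/-- With `a = ⟨α, α⟩`, the sum over roots reads `a = N (a / 2)²`, where `N` is a sum of squares of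
Cartan integers. As `a ≠ 0`, this gives `N a = 4`, so `a` is a positive rational. -/
theorem form_root_self_pos (α : t.root) :
    0 < form ((rootSystem t).root α) ((rootSystem t).root α) := by
  have h0 := form_root_self_ne_zero α
  set a := form ((rootSystem t).root α) ((rootSystem t).root α) with ha
  have h1 : a = (∑ β : t.root, ((rootSystem t).root β ((rootSystem t).coroot α)) ^ 2) *
      (a / 2) ^ 2 := by
    refine (form_eq_sum_roots _ _).trans ?_
    rw [Finset.sum_mul]
    refine Finset.sum_congr rfl fun β _ => ?_
    rw [form_comm, form_root_right, ← ha]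
    ring
  choose n hn using root_apply_coroot_eq_intCast α
  have h2 : (∑ β : t.root, ((rootSystem t).root β ((rootSystem t).coroot α)) ^ 2) =
      ((∑ β : t.root, (n β) ^ 2 : ℤ) : ℂ) := by
    push_cast
    exact Finset.sum_congr rfl fun β _ => by rw [hn]
  rw [h2] at h1
  set N : ℤ := ∑ β : t.root, (n β) ^ 2
  have hN0 : 0 ≤ N := Finset.sum_nonneg fun _ _ => sq_nonneg _
  have h3 : (N : ℂ) * a = 4 := by
    have : a * (N * a - 4) = 0 := by linear_combination (-4) * h1
    rcases mul_eq_zero.mp this with h | h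
    · exact absurd h h0
    · linear_combination h
  have hN1 : N ≠ 0 := by
    rintro h
    rw [h] at h3
    norm_num at h3
  have hN : (0 : ℂ) < N := by exact_mod_cast lt_of_le_of_ne hN0 hN1.symm
  have : a = 4 / N := by
    rw [eq_div_iff hN.ne', mul_comm, h3]
  rw [this]
  positivity

/-- `x` takes integral values on the coroots. -/
def IsIntegral (x : Module.Dual ℂ t) : Prop :=
  ∀ α : t.root, ∃ n : ℤ, x ((rootSystem t).coroot α) = n

theorem isIntegral_root (α : t.root) : IsIntegral ((rootSystem t).root α) := fun β =>
  root_apply_coroot_eq_intCast β α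

theorem IsIntegral.add {x y : Module.Dual ℂ t} (hx : IsIntegral x) (hy : IsIntegral y) :
    IsIntegral (x + y) := fun α => by
  obtain ⟨n, hn⟩ := hx α
  obtain ⟨m, hm⟩ := hy α
  exact ⟨n + m, by rw [LinearMap.add_apply, hn, hm, Int.cast_add]⟩

theorem IsIntegral.smul {x : Module.Dual ℂ t} (hx : IsIntegral x) (m : ℤ) :
    IsIntegral ((m : ℂ) • x) := fun α => by
  obtain ⟨n, hn⟩ := hx α
  exact ⟨m * n, by rw [LinearMap.smul_apply, hn, Int.cast_mul, smul_eq_mul]⟩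

/-- The pairing with a root is an integer times a positive number, hence real. These squares are the
terms of `form_eq_sum_roots`, so they yield both positivity and definiteness. -/
theorem IsIntegral.form_root_sq_nonneg {x : Module.Dual ℂ t} (hx : IsIntegral x) (α : t.root) :
    0 ≤ form x ((rootSystem t).root α) * form x ((rootSystem t).root α) := by
  obtain ⟨n, hn⟩ := hx α
  rw [form_root_right, hn, mul_mul_mul_comm]
  have h1 : (0 : ℂ) ≤ (n : ℂ) * n := by exact_mod_cast mul_self_nonneg n
  have h2 := form_root_self_pos α
  positivity

theorem IsIntegral.normSq_nonneg {x : Module.Dual ℂ t} (hx : IsIntegral x) : 0 ≤ normSq x := by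
  rw [normSq, form_eq_sum_roots]
  exact Finset.sum_nonneg fun α _ => hx.form_root_sq_nonneg α

theorem eq_zero_of_form_root_eq_zero {x : Module.Dual ℂ t}
    (h : ∀ α : t.root, form x ((rootSystem t).root α) = 0) : x = 0 := by
  have h1 : ∀ y, form y x = 0 := fun y => by
    rw [form_eq_sum_roots]
    exact Finset.sum_eq_zero fun β _ => by rw [h, mul_zero]
  have h2 : (cartanEquivDual t).symm x = 0 := by
    rw [← Module.forall_dual_apply_eq_zero_iff ℂ]
    intro f
    rw [← form_eq_apply, h1]
  simpa using h2

theorem IsIntegral.eq_zero_of_normSq_eq_zero {x : Module.Dual ℂ t} (hx : IsIntegral x)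
    (h : normSq x = 0) : x = 0 := by
  rw [normSq, form_eq_sum_roots, Finset.sum_eq_zero_iff_of_nonneg
    fun α _ => hx.form_root_sq_nonneg α] at h
  exact eq_zero_of_form_root_eq_zero fun α => mul_self_eq_zero.mp (h α (Finset.mem_univ _))

end RootForm

/-! ### The Weyl group action and a functional positive on `Δ⁺`. -/

section Weyl

variable {g : Type*} [LieRing g] [LieAlgebra ℂ g] [FiniteDimensional ℂ g]
  [LieAlgebra.IsSemisimple ℂ g] {t : LieSubalgebra ℂ g} [t.IsCartanSubalgebra]

theorem ofIdx_smul_eq (α : t.root) (x : Module.Dual ℂ t) :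
    weylGroup.ofIdx (rootSystem t) α • x =
      x - x ((rootSystem t).coroot α) • (rootSystem t).root α := by
  rw [weylGroup.ofIdx_smul]
  simp [reflection_apply]

theorem weyl_induction {p : (rootSystem t).weylGroup → Prop}
    (hr : ∀ α, p (weylGroup.ofIdx (rootSystem t) α)) (h1 : p 1)
    (hm : ∀ v w, p v → p w → p (v * w)) (w : (rootSystem t).weylGroup) : p w := by
  obtain ⟨w, hw⟩ := w
  induction hw using weylGroup.induction with
  | mem i => exact hr i
  | one => exact h1
  | mul x y hx hy hpx hpy => exact hm ⟨x, hx⟩ ⟨y, hy⟩ hpx hpy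

theorem apply_coroot_self (α : t.root) :
    (rootSystem t).root α ((rootSystem t).coroot α) = 2 :=
  root_apply_coroot (LieSubalgebra.isNonZero_coe_root α)

theorem form_smul_smul (w : (rootSystem t).weylGroup) (x y : Module.Dual ℂ t) :
    form (w • x) (w • y) = form x y := by
  induction w using weyl_induction generalizing x y with
  | hr α =>
    rw [ofIdx_smul_eq, ofIdx_smul_eq]
    simp only [form_sub_left, form_sub_right, form_smul_left, form_smul_right]
    rw [form_comm ((rootSystem t).root α) y, form_root_right x, form_root_right y,
      form_root_right ((rootSystem t).root α), apply_coroot_self]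
    ring
  | h1 => simp
  | hm v w hv hw => rw [mul_smul, mul_smul, hv, hw]

theorem normSq_smul (w : (rootSystem t).weylGroup) (x : Module.Dual ℂ t) :
    normSq (w • x) = normSq x := form_smul_smul w x x

/-- Roots span `t*`, so `w • x` depends only on the permutation of the finite set of roots induced
by `w`. Finiteness of the orbit lets a functional be maximized on it. -/
theorem finite_range_weyl_smul (x : Module.Dual ℂ t) :
    (Set.range fun w : (rootSystem t).weylGroup => w • x).Finite := by
  have key : ∀ v w : (rootSystem t).weylGroup,
      (rootSystem t).weylGroupToPerm v = (rootSystem t).weylGroupToPerm w → v • x = w • x := by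
    intro v w h
    have hx : x ∈ Submodule.span ℂ (Set.range (rootSystem t).root) := by
      rw [IsRootSystem.span_root_eq_top]
      trivial
    induction hx using Submodule.span_induction with
    | mem x hx =>
      obtain ⟨i, rfl⟩ := hx
      rw [weylGroup_apply_root, weylGroup_apply_root, h]
    | zero => simp
    | add x y _ _ hx hy => rw [smul_add, smul_add, hx, hy]
    | smul c x _ hx => rw [smul_comm v c x, smul_comm w c x, hx]
  have hf := Set.finite_range fun σ : Set.range (rootSystem t).weylGroupToPerm => σ.2.choose • x
  refine hf.subset ?_
  rintro _ ⟨w, rfl⟩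
  refine ⟨⟨_, w, rfl⟩, key _ _ ?_⟩
  exact (Set.mem_range_self (f := (rootSystem t).weylGroupToPerm) w).choose_spec

/-- The functional equal to `1` on each simple root takes a root to its height. -/
theorem exists_pos_functional (b : (rootSystem t).Base) :
    ∃ φ : Module.Dual ℂ t →ₗ[ℂ] ℂ, ∀ α ∈ posRoots b, 0 < φ ((rootSystem t).root α) := by
  refine ⟨b.toWeightBasis.constr ℂ fun _ => 1, fun α hα => ?_⟩
  have hpos : b.IsPos α := by simpa [posRoots] using hα
  obtain ⟨f, -, -, hf⟩ := b.exists_root_eq_sum_int α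
  have h1 : ∀ j ∈ b.support, (b.toWeightBasis.constr ℂ fun _ => (1 : ℂ))
      ((rootSystem t).root j) = 1 := by
    intro j hj
    rw [← b.toWeightBasis_apply ⟨j, hj⟩, Module.Basis.constr_basis]
  have h2 : (b.toWeightBasis.constr ℂ fun _ => (1 : ℂ)) ((rootSystem t).root α) =
      (b.height α : ℂ) := by
    rw [hf, map_sum, Base.height_eq_sum hf]
    push_cast
    refine Finset.sum_congr rfl fun j hj => ?_
    rw [map_zsmul, h1 j hj, zsmul_eq_mul, mul_one]
  rw [h2]
  exact_mod_cast (show 0 < b.height α from hpos)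

/-- The index of the negative of a root. -/
def negRoot (α : t.root) : t.root := (rootSystem t).reflectionPerm α α

theorem root_negRoot (α : t.root) :
    (rootSystem t).root (negRoot α) = -(rootSystem t).root α := by
  rw [negRoot, root_reflectionPerm, reflection_apply_self]

theorem negRoot_negRoot (α : t.root) : negRoot (negRoot α) = α := by
  apply (rootSystem t).root.injective
  rw [root_negRoot, root_negRoot, neg_neg]

theorem coe_negRoot (α : t.root) :
    ((negRoot α : t.root) : LieModule.Weight ℂ t g) = -(α : LieModule.Weight ℂ t g) := by
  have h := root_negRoot α
  rw [rootSystem_root_apply, rootSystem_root_apply] at h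
  ext x
  exact congrArg (fun f : Module.Dual ℂ t => f x) h

theorem mem_posRoots {b : (rootSystem t).Base} {α : t.root} : α ∈ posRoots b ↔ b.IsPos α := by
  simp [posRoots]

theorem negRoot_mem_posRoots {b : (rootSystem t).Base} {α : t.root} :
    negRoot α ∈ posRoots b ↔ α ∉ posRoots b := by
  rw [mem_posRoots, mem_posRoots]
  exact Base.IsPos.neg_iff_not b α

theorem sum_root_eq_sum_posRoots {M : Type*} [AddCommMonoid M] (b : (rootSystem t).Base)
    (f : t.root → M) : ∑ α, f α = ∑ α ∈ posRoots b, (f α + f (negRoot α)) := by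
  classical
  rw [← Finset.sum_filter_add_sum_filter_not Finset.univ (· ∈ posRoots b),
    Finset.sum_add_distrib]
  congr 1
  · exact Finset.sum_congr (by ext; simp) fun _ _ => rfl
  · refine Finset.sum_bij' (fun α _ => negRoot α) (fun α _ => negRoot α) ?_ ?_ ?_ ?_ ?_
    · intro α hα
      simpa [negRoot_mem_posRoots] using hα
    · intro α hα
      simpa [negRoot_mem_posRoots] using hα
    · intro α _
      exact negRoot_negRoot α
    · intro α _
      exact negRoot_negRoot α
    · intro α _
      rw [negRoot_negRoot]

/-! ### Signed half-sums of roots, and dominance. -/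

/-- `x` is the half-sum of a set of roots which contains exactly one root from each pair of opposite
roots; the function `χ` is `1` on the set and `-1` off it. -/
def IsSignedHalfSum (x : Module.Dual ℂ t) : Prop :=
  ∃ χ : t.root → ℂ, (∀ α, χ α = 1 ∨ χ α = -1) ∧ (∀ α, χ (negRoot α) = -χ α) ∧
    x = (1 / 4 : ℂ) • ∑ α, χ α • (rootSystem t).root α

/-- The Weyl group permutes the roots and commutes with negation, so the sign function can be
transported along the permutation. -/
theorem IsSignedHalfSum.smul {x : Module.Dual ℂ t} (hx : IsSignedHalfSum x)
    (w : (rootSystem t).weylGroup) : IsSignedHalfSum (w • x) := by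
  obtain ⟨χ, h1, h2, rfl⟩ := hx
  set π := (rootSystem t).weylGroupToPerm w with hπ
  have hneg : ∀ α, π (negRoot α) = negRoot (π α) := by
    intro α
    apply (rootSystem t).root.injective
    rw [root_negRoot, ← weylGroup_apply_root, ← weylGroup_apply_root, root_negRoot, smul_neg]
  refine ⟨fun α => χ (π.symm α), fun α => h1 _, fun α => ?_, ?_⟩
  · rw [← h2]
    refine congrArg χ ?_
    rw [Equiv.symm_apply_eq, hneg, Equiv.apply_symm_apply]
  · rw [smul_comm w, Finset.smul_sum]
    congr 1
    conv_rhs => rw [← Equiv.sum_comp π]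
    refine Finset.sum_congr rfl fun α _ => ?_
    rw [smul_comm w, weylGroup_apply_root]
    simp only [Equiv.symm_apply_apply]
    rw [hπ]

theorem isSignedHalfSum_rho_sub (b : (rootSystem t).Base) {A : Finset t.root}
    (hA : A ⊆ posRoots b) :
    IsSignedHalfSum (rho b - ∑ α ∈ A, (rootSystem t).root α) := by
  classical
  -- Subtracting `α ∈ A` from `ρ` turns `α / 2` into `-α / 2`, so the sign is reversed exactly on
  -- `A` and on `-A`. The factor `1 / 4` in the definition reflects that `α` and its negative
  -- contribute the same term.
  set χ : t.root → ℂ := fun α =>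
    if α ∈ posRoots b then (if α ∈ A then -1 else 1) else (if negRoot α ∈ A then 1 else -1) with hχ
  have hneg : ∀ α, χ (negRoot α) = -χ α := by
    intro α
    have hp := negRoot_mem_posRoots (b := b) (α := α)
    by_cases h : α ∈ posRoots b
    · have h' : negRoot α ∉ posRoots b := by simp [hp, h]
      simp only [hχ, h, h', if_true, if_false, negRoot_negRoot]
      split_ifs <;> simp
    · have h' : negRoot α ∈ posRoots b := by simp [hp, h]
      simp only [hχ, h, h', if_true, if_false]
      split_ifs <;> simp
  refine ⟨χ, fun α => ?_, hneg, ?_⟩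
  · simp only [hχ]
    split_ifs <;> simp
  · rw [sum_root_eq_sum_posRoots b]
    have h1 : ∀ α ∈ posRoots b, χ α • (rootSystem t).root α +
        χ (negRoot α) • (rootSystem t).root (negRoot α) =
        (2 : ℂ) • (rootSystem t).root α -
          (if α ∈ A then (4 : ℂ) • (rootSystem t).root α else 0) := by
      intro α hα
      rw [hneg, root_negRoot]
      by_cases h : α ∈ A
      · simp only [hχ, hα, h, if_true]
        module
      · simp only [hχ, hα, h, if_true, if_false]
        module
    rw [Finset.sum_congr rfl h1, Finset.sum_sub_distrib, Finset.sum_ite_mem,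
      Finset.inter_eq_right.mpr hA, ← Finset.smul_sum, ← Finset.smul_sum, rho]
    module

theorem isSignedHalfSum_rho (b : (rootSystem t).Base) : IsSignedHalfSum (rho b) := by
  simpa using isSignedHalfSum_rho_sub b (Finset.empty_subset _)

theorem IsSignedHalfSum.exists_eq_rho_sub {x : Module.Dual ℂ t} (hx : IsSignedHalfSum x)
    (b : (rootSystem t).Base) :
    ∃ A ⊆ posRoots b, x = rho b - ∑ α ∈ A, (rootSystem t).root α := by
  classical
  obtain ⟨χ, h1, h2, rfl⟩ := hx
  refine ⟨(posRoots b).filter fun α => χ α = -1, Finset.filter_subset _ _, ?_⟩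
  rw [sum_root_eq_sum_posRoots b, rho, Finset.sum_filter, Finset.smul_sum, Finset.smul_sum,
    ← Finset.sum_sub_distrib]
  refine Finset.sum_congr rfl fun α _ => ?_
  rw [h2, root_negRoot]
  rcases h1 α with h | h
  · have : ¬ (1 : ℂ) = -1 := by norm_num
    rw [h, if_neg this]
    module
  · rw [h, if_pos rfl]
    module

theorem nonneg_of_apply_coroot {x : Module.Dual ℂ t} {α : t.root} {n : ℤ}
    (hn : x ((rootSystem t).coroot α) = n) (h : 0 ≤ n) : 0 ≤ form x ((rootSystem t).root α) := by
  rw [form_root_right, hn]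
  have h1 : (0 : ℂ) ≤ n := by exact_mod_cast h
  have h2 := form_root_self_pos α
  positivity

/-- The reflection of `ρ` in `α` is again a signed half-sum, hence `ρ - ∑_A β` with `A ⊆ Δ⁺`. So
`ρ(α^∨) α` is a sum of positive roots, and a functional positive on `Δ⁺` shows `ρ(α^∨) ≥ 0`. -/
theorem rho_form_root_nonneg (b : (rootSystem t).Base) {α : t.root} (hα : α ∈ posRoots b) :
    0 ≤ form (rho b) ((rootSystem t).root α) := by
  obtain ⟨φ, hφ⟩ := exists_pos_functional b
  obtain ⟨A, hA, h⟩ := ((isSignedHalfSum_rho b).smul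
    (weylGroup.ofIdx (rootSystem t) α)).exists_eq_rho_sub b
  rw [ofIdx_smul_eq, sub_right_inj] at h
  have h1 := congrArg φ h
  rw [map_smul, map_sum, smul_eq_mul] at h1
  have h2 : 0 ≤ ∑ β ∈ A, φ ((rootSystem t).root β) :=
    Finset.sum_nonneg fun β hβ => (hφ β (hA hβ)).le
  have h3 : 0 ≤ (rho b) ((rootSystem t).coroot α) := by
    rw [eq_div_of_mul_eq (hφ α hα).ne' h1]
    have := hφ α hα
    positivity
  rw [form_root_right]
  have h4 := form_root_self_pos α
  positivity

theorem IsIntegral.smul_weyl {x : Module.Dual ℂ t} (hx : IsIntegral x)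
    (w : (rootSystem t).weylGroup) : IsIntegral (w • x) := by
  induction w using weyl_induction generalizing x with
  | hr α =>
    obtain ⟨n, hn⟩ := hx α
    rw [ofIdx_smul_eq, hn, sub_eq_add_neg, ← neg_smul]
    have := hx.add ((isIntegral_root α).smul (-n))
    push_cast at this
    exact this
  | h1 => simpa using hx
  | hm v w hv hw =>
    rw [mul_smul]
    exact hv (hw hx)

/-- A point of the finite orbit that maximizes the real part of `φ` is dominant: reflecting it in a
positive root `α` subtracts `n α`, which would increase `φ` if `n < 0`. -/
theorem IsIntegral.exists_isDominant {x : Module.Dual ℂ t} (hx : IsIntegral x)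
    (b : (rootSystem t).Base) : ∃ w : (rootSystem t).weylGroup, IsDominant b (w • x) := by
  obtain ⟨φ, hφ⟩ := exists_pos_functional b
  obtain ⟨_, ⟨w, rfl⟩, hw⟩ := Set.exists_max_image _ (fun y => (φ y).re)
    (finite_range_weyl_smul x) ⟨_, 1, rfl⟩
  refine ⟨w, fun α hα => ?_⟩
  obtain ⟨n, hn⟩ := hx.smul_weyl w α
  refine nonneg_of_apply_coroot hn ?_
  have h1 := hw _ ⟨weylGroup.ofIdx (rootSystem t) α * w, rfl⟩
  simp only [mul_smul] at h1
  rw [ofIdx_smul_eq, hn, map_sub, map_smul φ, smul_eq_mul, Complex.sub_re, Complex.mul_re] at h1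
  have h2 := Complex.pos_iff.mp (hφ α hα)
  simp only [Complex.intCast_re, Complex.intCast_im, zero_mul, sub_zero] at h1
  have h3 : 0 ≤ (n : ℝ) * (φ ((rootSystem t).root α)).re := by linarith
  exact_mod_cast nonneg_of_mul_nonneg_left h3 h2.1

end Weyl

/-! ### Weights of finite-dimensional representations: root strings and Weyl invariance. -/

section Weights

variable {g : Type*} [LieRing g] [LieAlgebra ℂ g] [FiniteDimensional ℂ g]
  [LieAlgebra.IsSemisimple ℂ g] {t : LieSubalgebra ℂ g} [t.IsCartanSubalgebra]
  {V : Type*} [AddCommGroup V] [Module ℂ V] [LieRingModule g V] [LieModule ℂ g V]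

/-- `v` is a (possibly zero) simultaneous eigenvector of `t` of weight `ν`. -/
def IsWeightVector (ν : Module.Dual ℂ t) (v : V) : Prop :=
  ∀ H : t, ⁅(H : g), v⁆ = ν H • v

theorem IsWeightVector.lie {ν : Module.Dual ℂ t} {v : V} (hv : IsWeightVector ν v) {α : t.root}
    {x : g} (hx : x ∈ LieAlgebra.rootSpace t (α : LieModule.Weight ℂ t g)) :
    IsWeightVector (ν + (rootSystem t).root α) ⁅x, v⁆ := by
  intro H
  have h1 : ⁅(H : g), x⁆ = (α : LieModule.Weight ℂ t g) H • x := lie_eq_smul_of_mem_rootSpace hx H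
  rw [leibniz_lie, h1, hv, smul_lie, lie_smul, ← add_smul, add_comm]
  rfl

theorem IsWeightVector.lie_pow {ν : Module.Dual ℂ t} {v : V} (hv : IsWeightVector ν v)
    {α : t.root} {x : g} (hx : x ∈ LieAlgebra.rootSpace t (α : LieModule.Weight ℂ t g)) (n : ℕ) :
    IsWeightVector (ν + (n : ℂ) • (rootSystem t).root α) ((LieModule.toEnd ℂ g V x ^ n) v) := by
  induction n with
  | zero => simpa using hv
  | succ n ih =>
    rw [pow_succ', Module.End.mul_apply, LieModule.toEnd_apply_apply, Nat.cast_succ, add_smul,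
      one_smul, ← add_assoc]
    exact ih.lie hx

theorem IsWeightVector.mem_genWeightSpace {ν : Module.Dual ℂ t} {v : V}
    (hv : IsWeightVector ν v) : v ∈ LieModule.genWeightSpace V (ν : t → ℂ) :=
  LieModule.weightSpace_le_genWeightSpace V _ ((LieModule.mem_weightSpace _ _).mpr hv)

variable (V) in
/-- `ν` is a weight of `V` with respect to `t`. -/
def HasWeight (ν : Module.Dual ℂ t) : Prop := ∃ v : V, v ≠ 0 ∧ IsWeightVector ν v

/-- The root space decomposition as an induction principle; the zero root space is `t` itself. -/
theorem rootSpace_induction {p : g → Prop} (cartan : ∀ H : t, p H)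
    (root : ∀ (α : t.root), ∀ x ∈ LieAlgebra.rootSpace t (α : LieModule.Weight ℂ t g), p x)
    (add : ∀ x y, p x → p y → p (x + y)) (x : g) : p x := by
  have hx : x ∈ ⨆ χ : LieModule.Weight ℂ t g, LieModule.genWeightSpace g χ := by
    rw [LieModule.iSup_genWeightSpace_eq_top' ℂ t g]
    trivial
  induction hx using LieSubmodule.iSup_induction' with
  | mem χ y hy =>
    by_cases h : χ.IsZero
    · rw [h.eq] at hy
      replace hy : y ∈ LieAlgebra.rootSpace t (0 : t → ℂ) := hy
      rw [LieAlgebra.rootSpace_zero_eq ℂ g t] at hy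
      exact cartan ⟨y, (LieSubalgebra.mem_toLieSubmodule y).mp hy⟩
    · exact root ⟨χ, by simpa [LieSubalgebra.root] using h⟩ y hy
  | zero => exact cartan 0
  | add y z _ _ hy hz => exact add y z hy hz

theorem IsWeightVector.eventually_zero [FiniteDimensional ℂ V] {ν : Module.Dual ℂ t} {v : V}
    (hv : IsWeightVector ν v) {α : t.root} {x : g}
    (hx : x ∈ LieAlgebra.rootSpace t (α : LieModule.Weight ℂ t g)) :
    ∃ n : ℕ, (LieModule.toEnd ℂ g V x ^ n) v = 0 := by
  obtain ⟨k, -, hk⟩ := LieModule.exists_genWeightSpace_smul_add_eq_bot (R := ℂ) V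
    ((α : LieModule.Weight ℂ t g) : t → ℂ) (ν : t → ℂ) (LieSubalgebra.isNonZero_coe_root α)
  refine ⟨k, ?_⟩
  have := LieAlgebra.toEnd_pow_apply_mem hx hv.mem_genWeightSpace k
  rw [hk] at this
  simpa using this

/-- In an `sl₂`-triple `(e, f)` for `α`, let `p` be the last exponent with `e ^ p v ≠ 0`. Then `e ^
p v` is primitive, its weight on the coroot is a natural number `m`, and its images under `f ^ k`
for `k ≤ m` are nonzero. -/
theorem HasWeight.string [FiniteDimensional ℂ V] {ν : Module.Dual ℂ t} (hν : HasWeight V ν)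
    (α : t.root) :
    ∃ p m : ℕ, ν ((rootSystem t).coroot α) + 2 * p = m ∧
      ∀ k ≤ m, HasWeight V (ν + (p : ℂ) • (rootSystem t).root α -
        (k : ℂ) • (rootSystem t).root α) := by
  obtain ⟨v, hv0, hv⟩ := hν
  have hα := LieSubalgebra.isNonZero_coe_root α
  obtain ⟨c, e, f, hs, he, hf⟩ := exists_isSl2Triple_of_weight_isNonZero hα
  have hc : c = (rootSystem t).coroot α := hs.h_eq_coroot hα he hf
  have hf' : f ∈ LieAlgebra.rootSpace t ((negRoot α : t.root) : LieModule.Weight ℂ t g) := by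
    rw [coe_negRoot]
    exact hf
  obtain ⟨p, hp, hp'⟩ := Nat.exists_not_and_succ_of_not_zero_of_exists
    (p := fun n => (LieModule.toEnd ℂ g V e ^ n) v = 0) (by simpa using hv0)
    (hv.eventually_zero he)
  have hu := hv.lie_pow he p
  have P : hs.HasPrimitiveVectorWith ((LieModule.toEnd ℂ g V e ^ p) v)
      (ν ((rootSystem t).coroot α) + 2 * p) := by
    refine ⟨hp, ?_, ?_⟩
    · rw [hc, hu, LinearMap.add_apply, LinearMap.smul_apply, apply_coroot_self, smul_eq_mul,
        mul_comm (p : ℂ)]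
    · rw [← LieModule.toEnd_apply_apply ℂ, ← Module.End.mul_apply, ← pow_succ']
      exact hp'
  obtain ⟨m, hm⟩ := P.exists_nat
  refine ⟨p, m, hm, fun k hk => ⟨_, P.pow_toEnd_f_ne_zero_of_eq_nat hm hk, ?_⟩⟩
  have := hu.lie_pow hf' k
  rwa [root_negRoot, smul_neg, ← sub_eq_add_neg] at this

theorem HasWeight.isIntegral [FiniteDimensional ℂ V] {ν : Module.Dual ℂ t}
    (hν : HasWeight V ν) : IsIntegral ν := fun α => by
  obtain ⟨p, m, h, -⟩ := hν.string α
  exact ⟨m - 2 * p, by push_cast; linear_combination h⟩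

theorem coroot_negRoot (α : t.root) :
    (rootSystem t).coroot (negRoot α) = -(rootSystem t).coroot α := by
  rw [rootSystem_coroot_apply, rootSystem_coroot_apply, coe_negRoot, coroot_neg]

theorem HasWeight.smul [FiniteDimensional ℂ V] {ν : Module.Dual ℂ t} (hν : HasWeight V ν)
    (w : (rootSystem t).weylGroup) : HasWeight V (w • ν) := by
  have key : ∀ {ν : Module.Dual ℂ t} (_ : HasWeight V ν) (α : t.root) (n : ℤ)
      (_ : ν ((rootSystem t).coroot α) = n) (_ : 0 ≤ n),
      HasWeight V (ν - (n : ℂ) • (rootSystem t).root α) := by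
    intro ν hν α n hn h0
    obtain ⟨p, m, hm, hs⟩ := hν.string α
    rw [hn] at hm
    have hm' : n + 2 * p = m := by exact_mod_cast hm
    -- The target `ν - n α` lies `p + n` steps below the top of the string, and `p + n = m - p`.
    have := hs (m - p) (Nat.sub_le _ _)
    rw [Nat.cast_sub (by lia), ← hm] at this
    convert this using 1
    module
  induction w using weyl_induction generalizing ν with
  | hr α =>
    obtain ⟨n, hn⟩ := hν.isIntegral α
    rw [ofIdx_smul_eq, hn]
    rcases le_total 0 n with h | h
    · exact key hν α n hn h
    · have := key hν (negRoot α) (-n) (by rw [coroot_negRoot, map_neg, hn]; push_cast; rfl)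
        (by lia)
      rw [root_negRoot] at this
      push_cast at this
      rwa [neg_smul_neg] at this
  | h1 => simpa using hν
  | hm v w hv hw =>
    rw [mul_smul]
    exact hv (hw hν)

/-! ### Weights lie below the highest weight. -/

theorem IsHighestWeight.hasWeight {b : (rootSystem t).Base} {lam : Module.Dual ℂ t}
    (h : IsHighestWeight b V lam) : HasWeight V lam := by
  obtain ⟨v, hv, h, -⟩ := h
  exact ⟨v, hv, h⟩

/-- The monoid generated by the positive roots. -/
def posCone (b : (rootSystem t).Base) : AddSubmonoid (Module.Dual ℂ t) :=
  AddSubmonoid.closure ((rootSystem t).root '' (posRoots b : Set t.root))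

/-- The vectors obtained from `v₀` by applying successively negative root vectors. -/
inductive IsDescendant (b : (rootSystem t).Base) (v₀ : V) : V → Prop
  | refl : IsDescendant b v₀ v₀
  | lie (α : t.root) (hα : α ∉ posRoots b) (x : g)
      (hx : x ∈ LieAlgebra.rootSpace t (α : LieModule.Weight ℂ t g)) (v : V)
      (hv : IsDescendant b v₀ v) : IsDescendant b v₀ ⁅x, v⁆

theorem IsDescendant.exists_isWeightVector {b : (rootSystem t).Base} {lam : Module.Dual ℂ t}
    {v₀ v : V} (h₀ : IsWeightVector lam v₀) (hv : IsDescendant b v₀ v) :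
    ∃ γ ∈ posCone b, IsWeightVector (lam - γ) v := by
  induction hv with
  | refl => exact ⟨0, zero_mem _, by simpa using h₀⟩
  | lie α hα x hx v hv ih =>
    obtain ⟨γ, hγ, h⟩ := ih
    refine ⟨γ + (rootSystem t).root (negRoot α), add_mem hγ (AddSubmonoid.subset_closure
      ⟨_, negRoot_mem_posRoots.mpr hα, rfl⟩), ?_⟩
    rw [root_negRoot, ← sub_eq_add_neg, sub_sub_eq_add_sub, add_sub_right_comm]
    exact h.lie hx

/-- The span of the descendants is a nonzero `g`-submodule, so irreducibility applies. Stability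
under all of `g` follows by induction on descendants from `x y v = [x, y] v + y x v`, which replaces
the Poincaré–Birkhoff–Witt theorem. -/
theorem span_isDescendant_eq_top [LieModule.IsIrreducible ℂ g V] {b : (rootSystem t).Base}
    {lam : Module.Dual ℂ t} {v₀ : V} (h0 : v₀ ≠ 0) (h₀ : IsWeightVector lam v₀)
    (hk : ∀ α ∈ posRoots b, ∀ x ∈ LieAlgebra.rootSpace t (α : LieModule.Weight ℂ t g),
      ⁅x, v₀⁆ = 0) :
    Submodule.span ℂ {v | IsDescendant b v₀ v} = ⊤ := by
  set N := Submodule.span ℂ {v | IsDescendant b v₀ v} with hN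
  have hneg : ∀ α ∉ posRoots b, ∀ x ∈ LieAlgebra.rootSpace t (α : LieModule.Weight ℂ t g),
      ∀ v ∈ N, ⁅x, v⁆ ∈ N := by
    intro α hα x hx v hv
    induction hv using Submodule.span_induction with
    | mem v hv => exact Submodule.subset_span (IsDescendant.lie α hα x hx v hv)
    | zero => simp
    | add v w _ _ hv hw =>
      rw [lie_add]
      exact add_mem hv hw
    | smul c v _ hv =>
      rw [lie_smul]
      exact N.smul_mem c hv
  have hmem : ∀ v, IsDescendant b v₀ v → ∀ x : g, ⁅x, v⁆ ∈ N := by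
    intro v hv
    induction hv with
    | refl =>
      have hv₀ : v₀ ∈ N := Submodule.subset_span IsDescendant.refl
      intro x
      refine rootSpace_induction (t := t) (p := fun x => ⁅x, v₀⁆ ∈ N) ?_ ?_ ?_ x
      · intro H
        rw [h₀ H]
        exact N.smul_mem _ hv₀
      · intro α x hx
        by_cases hα : α ∈ posRoots b
        · rw [hk α hα x hx]
          exact N.zero_mem
        · exact hneg α hα x hx v₀ hv₀
      · intro x y hx hy
        rw [add_lie]
        exact add_mem hx hy
    | lie α hα y hy v hv ih =>
      intro x
      rw [leibniz_lie]
      -- The induction hypothesis holds for every element of `g`, so it covers the bracket, whatever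
      -- root space that lies in.
      exact add_mem (ih _) (hneg α hα y hy _ (ih x))
  let N' : LieSubmodule ℂ g V :=
    { N with
      lie_mem := by
        intro x v hv
        change v ∈ N at hv
        change ⁅x, v⁆ ∈ N
        induction hv using Submodule.span_induction with
        | mem v hv => exact hmem v hv x
        | zero => simp
        | add v w _ _ hv hw =>
          rw [lie_add]
          exact add_mem hv hw
        | smul c v _ hv =>
          rw [lie_smul]
          exact N.smul_mem c hv }
  have hN' : N' = ⊤ := by
    refine (eq_bot_or_eq_top N').resolve_left fun h => h0 ?_
    have : v₀ ∈ N' := Submodule.subset_span (IsDescendant.refl (b := b))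
    rwa [h, LieSubmodule.mem_bot] at this
  exact congrArg LieSubmodule.toSubmodule hN'

/-- `V` is spanned by vectors of weights `λ - γ` with `γ` in the cone. If `ν` were not among these
weights, its weight space would be independent of all of `V`, hence zero. -/
theorem IsHighestWeight.sub_mem_posCone [LieModule.IsIrreducible ℂ g V]
    {b : (rootSystem t).Base} {lam ν : Module.Dual ℂ t} (h : IsHighestWeight b V lam)
    (hν : HasWeight V ν) : lam - ν ∈ posCone b := by
  obtain ⟨v₀, h0, h₀, hk⟩ := h
  obtain ⟨v, hv0, hv⟩ := hν
  by_contra hcon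
  refine hv0 ?_
  have hind := LieModule.iSupIndep_genWeightSpace ℂ t V (ν : t → ℂ)
  have htop : (⊤ : Submodule ℂ V) ≤
      (⨆ χ, ⨆ (_ : χ ≠ (ν : t → ℂ)), LieModule.genWeightSpace V χ).toSubmodule := by
    rw [← span_isDescendant_eq_top h0 h₀ hk, Submodule.span_le]
    intro u hu
    obtain ⟨γ, hγ, huγ⟩ := IsDescendant.exists_isWeightVector h₀ hu
    have hne : ((lam - γ : Module.Dual ℂ t) : t → ℂ) ≠ (ν : t → ℂ) := by
      intro heq
      have : lam - γ = ν := DFunLike.coe_injective heq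
      rw [← this, sub_sub_cancel] at hcon
      exact hcon hγ
    exact (le_iSup₂_of_le (f := fun (χ : t → ℂ) (_ : χ ≠ (ν : t → ℂ)) =>
      LieModule.genWeightSpace V χ) _ hne le_rfl) huγ.mem_genWeightSpace
  have := hind.le_bot ⟨hv.mem_genWeightSpace, htop trivial⟩
  simpa using this

theorem form_nonneg_of_mem_posCone {b : (rootSystem t).Base} {x γ : Module.Dual ℂ t}
    (hx : IsDominant b x) (hγ : γ ∈ posCone b) : 0 ≤ form x γ := by
  induction hγ using AddSubmonoid.closure_induction with
  | mem y hy =>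
    obtain ⟨α, hα, rfl⟩ := hy
    exact hx α hα
  | zero => rw [form_comm, form_zero_left]
  | add y z _ _ hy hz =>
    rw [form_add_right]
    exact add_nonneg hy hz

theorem isDominant_rho (b : (rootSystem t).Base) : IsDominant b (rho b) :=
  fun _ hα => rho_form_root_nonneg b hα

end Weights

/-! ### The identity behind the inequality. -/

section Inequality

variable {g : Type*} [LieRing g] [LieAlgebra ℂ g] [FiniteDimensional ℂ g]
  [LieAlgebra.IsSemisimple ℂ g] {t : LieSubalgebra ℂ g} [t.IsCartanSubalgebra]

/-- The difference is `‖λ‖² - ‖ν‖² + 2⟨λ, ρ⟩ - 2⟨ν, κ⟩`. Invariance turns `⟨ν, κ⟩` into `⟨wν, ρ -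
σ⟩`, and `‖λ‖² - ‖wν‖²` splits as `‖λ - wν‖² + 2⟨wν, λ - wν⟩`. -/
theorem normSq_diff_eq (b : (rootSystem t).Base) (lam ν κ σ : Module.Dual ℂ t)
    (w : (rootSystem t).weylGroup) (hσ : w • κ = rho b - σ) :
    normSq (lam + rho b) - normSq (ν + κ) - (normSq (rho b) - normSq κ) =
      normSq (lam - w • ν) + 2 * form (w • ν) (lam - w • ν) + 2 * form (rho b) (lam - w • ν) +
        2 * form (w • ν) σ := by
  have h1 : form ν κ = form (w • ν) (rho b - σ) := by rw [← hσ, form_smul_smul]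
  have h2 : normSq ν = normSq (w • ν) := (normSq_smul w ν).symm
  simp only [normSq, form_add_left, form_add_right, form_sub_left, form_sub_right] at *
  rw [form_comm κ ν, h1, form_comm (rho b) lam, form_comm lam (w • ν), form_comm (rho b) (w • ν)]
  linear_combination -h2

end Inequality

/-! ### Joint eigenvectors of commuting idempotents. -/

section CommutingIdempotents

/-- A nonzero vector can be moved into a joint eigenspace of finitely many commuting idempotents. -/
theorem exists_joint_eigenvector {κ A S : Type*} [Ring A] [Algebra ℂ A] [AddCommGroup S]
    [Module ℂ S] [Module A S] [IsScalarTower ℂ A S] (P : κ → A) (D : Finset κ)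
    (hidem : ∀ i ∈ D, P i * P i = P i) (hcomm : ∀ i ∈ D, ∀ j ∈ D, Commute (P i) (P j))
    {s : S} (hs : s ≠ 0) :
    ∃ a : A, (∀ c, (∀ i ∈ D, Commute c (P i)) → Commute c a) ∧ a • s ≠ 0 ∧
      ∀ i ∈ D, (2 * P i - 1) • a • s = a • s ∨ (2 * P i - 1) • a • s = -(a • s) := by
  classical
  induction D using Finset.induction_on with
  | empty => exact ⟨1, fun c _ => Commute.one_right c, by simpa using hs, by simp⟩
  | insert j D hj ih =>
    obtain ⟨a, ha, has, hD⟩ := ih (fun i hi => hidem i (Finset.mem_insert_of_mem hi))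
      (fun i hi k hk => hcomm i (Finset.mem_insert_of_mem hi) k (Finset.mem_insert_of_mem hk))
    -- If `P j` kills the current vector, that vector already has eigenvalue `-1` under `2 P j - 1`;
    -- otherwise its image under `P j` is nonzero and has eigenvalue `1`.
    by_cases h : P j • a • s = 0
    · refine ⟨a, fun c hc => ha c fun i hi => hc i (Finset.mem_insert_of_mem hi), has, ?_⟩
      intro i hi
      rcases Finset.mem_insert.mp hi with rfl | hi
      · right
        rw [sub_smul, mul_smul, h, smul_zero, one_smul, zero_sub]
      · exact hD i hi
    · refine ⟨P j * a, fun c hc => (hc j (Finset.mem_insert_self _ _)).mul_right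
        (ha c fun i hi => hc i (Finset.mem_insert_of_mem hi)), by rwa [mul_smul], ?_⟩
      intro i hi
      rcases Finset.mem_insert.mp hi with rfl | hi
      · left
        rw [← mul_smul, ← mul_assoc, sub_mul, mul_assoc 2, hidem i (Finset.mem_insert_self _ _),
          one_mul, two_mul, add_sub_cancel_right]
      · have hc : Commute (2 * P i - 1) (P j) := by
          have h1 := hcomm i (Finset.mem_insert_of_mem hi) j (Finset.mem_insert_self _ _)
          exact ((Nat.cast_commute 2 (P j)).mul_left h1).sub_left (Commute.one_left _)
        have hr : (2 * P i - 1) • (P j * a) • s = P j • (2 * P i - 1) • a • s := by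
          rw [mul_smul, ← mul_smul (2 * P i - 1) (P j), hc.eq, mul_smul]
        rw [hr]
        rcases hD i hi with h | h
        · left
          rw [h, mul_smul]
        · right
          rw [h, mul_smul, smul_neg]

end CommutingIdempotents

/-! ### Dual root vectors and their position relative to `h` and `q`. -/

section RootVectors

variable {g : Type*} [LieRing g] [LieAlgebra ℂ g]

theorem eq_zero_of_mem_of_mem_complement {h : LieSubalgebra ℂ g}
    (hB : (complementForm h).Nondegenerate) {x : g} (hx : x ∈ h) (hx' : x ∈ complement h) :
    x = 0 :=
  congrArg Subtype.val (hB.1 ⟨x, hx'⟩ fun y => y.2 x hx)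

variable [FiniteDimensional ℂ g] {t : LieSubalgebra ℂ g} [t.IsCartanSubalgebra]

open Classical in
/-- The root vector `X α` if it lies in the complement of `h`, and zero otherwise. -/
def complementVector (h : LieSubalgebra ℂ g) (X : t.root → g) (α : t.root) : complement h :=
  if hα : X α ∈ complement h then ⟨X α, hα⟩ else 0

theorem coe_complementVector {h : LieSubalgebra ℂ g} {X : t.root → g} {α : t.root}
    (hα : X α ∈ complement h) : (complementVector h X α : g) = X α := by
  rw [complementVector, dif_pos hα]

theorem complementVector_eq_zero {h : LieSubalgebra ℂ g} {X : t.root → g} {α : t.root}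
    (hα : X α ∉ complement h) : complementVector h X α = 0 := by
  rw [complementVector, dif_neg hα]

variable [LieAlgebra.IsSemisimple ℂ g]

/-- `X` is a family of root vectors such that those of opposite roots are dual to each other. -/
structure IsDualRootFamily (X : t.root → g) : Prop where
  mem : ∀ α : t.root, X α ∈ LieAlgebra.rootSpace t (α : LieModule.Weight ℂ t g)
  killing : ∀ α, killingForm ℂ g (X α) (X (negRoot α)) = 1

theorem exists_isDualRootFamily (b : (rootSystem t).Base) :
    ∃ X : t.root → g, IsDualRootFamily X := by
  classical
  have key : ∀ α : t.root, ∃ e f : g,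
      e ∈ LieAlgebra.rootSpace t (α : LieModule.Weight ℂ t g) ∧
      f ∈ LieAlgebra.rootSpace t ((negRoot α : t.root) : LieModule.Weight ℂ t g) ∧
      killingForm ℂ g e f = 1 := by
    intro α
    obtain ⟨e, he, he0⟩ := (α : LieModule.Weight ℂ t g).exists_ne_zero
    obtain ⟨f, hf, hef⟩ : ∃ f ∈ LieAlgebra.rootSpace t (-(α : LieModule.Weight ℂ t g) : t → ℂ),
        killingForm ℂ g e f ≠ 0 := by
      contrapose! he0
      have := LieAlgebra.mem_ker_killingForm_of_mem_rootSpace_of_forall_rootSpace_neg ℂ g t he he0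
      simpa using this
    refine ⟨e, (killingForm ℂ g e f)⁻¹ • f, he, ?_, ?_⟩
    · rw [coe_negRoot]
      exact Submodule.smul_mem _ _ hf
    · rw [map_smul, smul_eq_mul, inv_mul_cancel₀ hef]
  choose e f he hf hef using key
  -- Dual pairs are chosen independently for each root, so only those indexed by positive roots are
  -- kept: `e` serves the positive root and its partner `f` the opposite one.
  refine ⟨fun α => if α ∈ posRoots b then e α else f (negRoot α), ?_, ?_⟩
  · intro α
    split_ifs with h
    · exact he α
    · have := hf (negRoot α)
      rwa [negRoot_negRoot] at this
  · intro α
    have hp := negRoot_mem_posRoots (b := b) (α := α)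
    by_cases h : α ∈ posRoots b
    · have h' : negRoot α ∉ posRoots b := by simp [hp, h]
      rw [if_pos h, if_neg h', negRoot_negRoot, hef]
    · have h' : negRoot α ∈ posRoots b := by simp [hp, h]
      rw [if_neg h, if_pos h', LieModule.traceForm_comm, hef]

namespace IsDualRootFamily

variable {X : t.root → g} (hX : IsDualRootFamily X)

include hX

theorem ne_zero (α : t.root) : X α ≠ 0 := by
  intro h
  have := hX.killing α
  rw [h, map_zero, LinearMap.zero_apply] at this
  exact zero_ne_one this

theorem exists_eq_smul {α : t.root} {x : g}
    (hx : x ∈ LieAlgebra.rootSpace t (α : LieModule.Weight ℂ t g)) : ∃ c : ℂ, x = c • X α := by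
  have h1 := finrank_rootSpace_eq_one (α : LieModule.Weight ℂ t g)
    (LieSubalgebra.isNonZero_coe_root α)
  have h2 := (finrank_eq_one_iff_of_nonzero'
    (⟨X α, hX.mem α⟩ : LieAlgebra.rootSpace t (α : LieModule.Weight ℂ t g))
    (fun h => hX.ne_zero α (congrArg Subtype.val h))).mp h1 ⟨x, hx⟩
  obtain ⟨c, hc⟩ := h2
  exact ⟨c, (congrArg Subtype.val hc).symm⟩

theorem killing_eq_zero {α β : t.root} (h : β ≠ negRoot α) :
    killingForm ℂ g (X α) (X β) = 0 := by
  refine LieAlgebra.killingForm_apply_eq_zero_of_mem_rootSpace_of_add_ne_zero ℂ g t (hX.mem α) (hX.mem β) ?_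
  intro h0
  apply h
  apply Subtype.ext
  rw [coe_negRoot]
  ext x
  have := congrFun h0 x
  simp only [Pi.add_apply, Pi.zero_apply] at this
  exact (neg_eq_of_add_eq_zero_right this).symm

theorem lie (H : t) (α : t.root) : ⁅(H : g), X α⁆ = (rootSystem t).root α H • X α :=
  lie_eq_smul_of_mem_rootSpace (hX.mem α) H

theorem rootSpace_le_iff (h : LieSubalgebra ℂ g) (α : t.root) :
    (LieAlgebra.rootSpace t (α : LieModule.Weight ℂ t g)).toSubmodule ≤ h.toSubmodule ↔
      X α ∈ h := by
  refine ⟨fun hle => hle (hX.mem α), fun hm x hx => ?_⟩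
  obtain ⟨c, rfl⟩ := hX.exists_eq_smul hx
  exact h.smul_mem c hm

/-- Since `t ≤ h`, the subalgebra is the sum of its intersections with the root spaces. Only the
component in the root space of `α` could pair with the opposite root vector, and that component is
zero because root spaces are lines. -/
theorem mem_complement_of_notMem {h : LieSubalgebra ℂ g} (ht : t ≤ h) {α : t.root}
    (hα : X α ∉ h) : X (negRoot α) ∈ complement h := by
  let N : LieSubmodule ℂ t g :=
    { h.toSubmodule with lie_mem := fun {H x} hx => h.lie_mem (ht H.2) hx }
  intro z hz
  change killingForm ℂ g z (X (negRoot α)) = 0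
  replace hz : z ∈ N := hz
  rw [LieModule.eq_iSup_inf_genWeightSpace _ _ _ N] at hz
  induction hz using LieSubmodule.iSup_induction' with
  | mem χ y hy =>
    obtain ⟨hyN, hyχ⟩ := hy
    by_cases hχ : χ = (α : LieModule.Weight ℂ t g)
    · subst hχ
      obtain ⟨c, rfl⟩ := hX.exists_eq_smul hyχ
      have hc : c = 0 := by
        by_contra hc
        apply hα
        have := h.smul_mem c⁻¹ (show c • X α ∈ h from hyN)
        rwa [smul_smul, inv_mul_cancel₀ hc, one_smul] at this
      rw [hc, zero_smul, map_zero, LinearMap.zero_apply]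
    · refine LieAlgebra.killingForm_apply_eq_zero_of_mem_rootSpace_of_add_ne_zero ℂ g t hyχ
        (hX.mem (negRoot α)) ?_
      intro h0
      apply hχ
      ext x
      have := congrFun h0 x
      rw [coe_negRoot] at this
      simp only [Pi.add_apply, Pi.zero_apply, LieModule.Weight.coe_neg, Pi.neg_apply] at this
      linear_combination this
  | zero => rw [map_zero, LinearMap.zero_apply]
  | add y z _ _ hy hz => rw [map_add, LinearMap.add_apply, hy, hz, add_zero]

/-- Otherwise `X α` would lie in both `h` and `q`, which meet trivially by nondegeneracy. The roots
of `h` are thus closed under negation, so each root vector lies in exactly one of `h` and `q`. -/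
theorem negRoot_mem {h : LieSubalgebra ℂ g} (hB : (complementForm h).Nondegenerate) (ht : t ≤ h)
    {α : t.root} (hα : X α ∈ h) : X (negRoot α) ∈ h := by
  by_contra hcon
  have := hX.mem_complement_of_notMem ht hcon
  rw [negRoot_negRoot] at this
  exact hX.ne_zero α (eq_zero_of_mem_of_mem_complement hB hα this)

theorem mem_complement_iff {h : LieSubalgebra ℂ g} (hB : (complementForm h).Nondegenerate)
    (ht : t ≤ h) (α : t.root) : X α ∈ complement h ↔ X α ∉ h := by
  refine ⟨fun h1 h2 => hX.ne_zero α (eq_zero_of_mem_of_mem_complement hB h2 h1), fun h1 => ?_⟩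
  have h2 : X (negRoot α) ∉ h := by
    intro h2
    have := hX.negRoot_mem hB ht h2
    rw [negRoot_negRoot] at this
    exact h1 this
  have := hX.mem_complement_of_notMem ht h2
  rwa [negRoot_negRoot] at this

end IsDualRootFamily

/-! ### The spin representation in terms of root vectors, and its weights. -/

namespace IsDualRootFamily

variable {X : t.root → g} (hX : IsDualRootFamily X)

include hX

theorem complementForm_eq_zero (h : LieSubalgebra ℂ g) {α β : t.root} (hαβ : β ≠ negRoot α) :
    complementForm h (complementVector h X α) (complementVector h X β) = 0 := by
  by_cases hα : X α ∈ complement h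
  · by_cases hβ : X β ∈ complement h
    · rw [complementForm_apply, coe_complementVector hα, coe_complementVector hβ,
        hX.killing_eq_zero hαβ]
    · rw [complementVector_eq_zero hβ, map_zero]
  · rw [complementVector_eq_zero hα, map_zero, LinearMap.zero_apply]

theorem negRoot_mem_complement {h : LieSubalgebra ℂ g} (hB : (complementForm h).Nondegenerate)
    (ht : t ≤ h) {α : t.root} (hα : X α ∈ complement h) : X (negRoot α) ∈ complement h := by
  rw [hX.mem_complement_iff hB ht] at hα ⊢
  intro h2
  have := hX.negRoot_mem hB ht h2
  rw [negRoot_negRoot] at this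
  exact hα this

theorem complementForm_eq_one {h : LieSubalgebra ℂ g} (hB : (complementForm h).Nondegenerate)
    (ht : t ≤ h) {α : t.root} (hα : X α ∈ complement h) :
    complementForm h (complementVector h X α) (complementVector h X (negRoot α)) = 1 := by
  rw [complementForm_apply, coe_complementVector hα,
    coe_complementVector (hX.negRoot_mem_complement hB ht hα), hX.killing]

/-- The root vectors in `q` and their opposites behave as dual bases of `q`. The difference of the
two sides is orthogonal to `h` as an element of `q`, and to the root vectors in `q` by duality, so
it is zero. -/
theorem sum_complementForm_smul {h : LieSubalgebra ℂ g} (hB : (complementForm h).Nondegenerate)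
    (ht : t ≤ h) (x : complement h) :
    ∑ α, complementForm h x (complementVector h X (negRoot α)) • complementVector h X α = x := by
  symm
  rw [← sub_eq_zero]
  set y := x - ∑ α, complementForm h x (complementVector h X (negRoot α)) •
    complementVector h X α with hy
  have hk : ∀ z : g, killingForm ℂ g (y : g) z = 0 := by
    refine rootSpace_induction (t := t) ?_ ?_ ?_
    · intro H
      rw [LieModule.traceForm_comm]
      exact y.2 H (ht H.2)
    · intro β z hz
      obtain ⟨c, rfl⟩ := hX.exists_eq_smul hz
      rw [map_smul]
      by_cases hβ : X β ∈ complement h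
      · have h1 : complementForm h y (complementVector h X β) = 0 := by
          rw [hy, map_sub, LinearMap.sub_apply, map_sum, LinearMap.sum_apply,
            Finset.sum_eq_single (negRoot β)]
          · have h2 := hX.complementForm_eq_one hB ht (hX.negRoot_mem_complement hB ht hβ)
            rw [negRoot_negRoot] at h2
            rw [map_smul, LinearMap.smul_apply, negRoot_negRoot, h2, smul_eq_mul, mul_one, sub_self]
          · intro α _ hα
            rw [map_smul, LinearMap.smul_apply, hX.complementForm_eq_zero h, smul_zero]
            rintro rfl
            exact hα (negRoot_negRoot α).symm
          · simp
        rw [complementForm_apply, coe_complementVector hβ] at h1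
        rw [h1, smul_zero]
      · rw [hX.mem_complement_iff hB ht, not_not] at hβ
        rw [LieModule.traceForm_comm]
        have : killingForm ℂ g (X β) y = 0 := y.2 _ hβ
        erw [this]
        exact smul_zero c
    · intro a c ha hc
      rw [map_add, ha, hc, add_zero]
  exact Subtype.ext ((LieAlgebra.IsKilling.killingForm_nondegenerate ℂ g).1 _ hk)

theorem adComplement_apply {h : LieSubalgebra ℂ g} (ht : t ≤ h) (H : t) (α : t.root) :
    adComplement h ⟨H, ht H.2⟩ (complementVector h X α) =
      (rootSystem t).root α H • complementVector h X α := by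
  by_cases hα : X α ∈ complement h
  · apply Subtype.ext
    rw [coe_adComplement_apply, Submodule.coe_smul, coe_complementVector hα, hX.lie]
  · rw [complementVector_eq_zero hα, map_zero, smul_zero]

/-- The element `∑ [Y, eᵢ] ẽᵢ` does not depend on the dual bases: expanding `eᵢ` in root vectors and
summing over `i` first replaces the given bases by root vectors, on which `t` acts by scalars. -/
theorem spinMap_eq_sum {h : LieSubalgebra ℂ g} (hB : (complementForm h).Nondegenerate)
    (ht : t ≤ h) (H : t) :
    spinMap h hB ⟨H, ht H.2⟩ = (1 / 2 : ℂ) • ∑ α, (rootSystem t).root α H •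
      (CliffordAlgebra.ι (cliffordForm h) (complementVector h X α) *
        CliffordAlgebra.ι (cliffordForm h) (complementVector h X (negRoot α))) := by
  set e := Module.finBasis ℂ (complement h) with he
  set e' := (complementForm h).dualBasis hB e with he'
  set κ := CliffordAlgebra.ι (cliffordForm h) with hκ
  have h1 : ∀ z, ∑ i, complementForm h (e i) z • e' i = z := by
    intro z
    conv_rhs => rw [← e'.sum_repr z]
    refine Finset.sum_congr rfl fun i _ => ?_
    rw [he', LinearMap.BilinForm.dualBasis_repr_apply, (complementForm_isSymm h).eq]
  have h2 : ∀ i, κ (adComplement h ⟨H, ht H.2⟩ (e i)) * κ (e' i) =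
      ∑ α, (rootSystem t).root α H • (κ (complementVector h X α) *
        (complementForm h (e i) (complementVector h X (negRoot α)) • κ (e' i))) := by
    intro i
    conv_lhs => rw [← hX.sum_complementForm_smul hB ht (e i)]
    simp only [map_sum, map_smul, hX.adComplement_apply ht, Finset.sum_mul, smul_mul_assoc,
      mul_smul_comm]
    exact Finset.sum_congr rfl fun α _ => smul_comm _ _ _
  rw [spinMap_apply, ← he, ← he', ← hκ, Finset.sum_congr rfl fun i _ => h2 i, Finset.sum_comm]
  congr 1
  refine Finset.sum_congr rfl fun α _ => ?_
  rw [← Finset.smul_sum, ← Finset.mul_sum]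
  simp only [← map_smul]
  rw [← map_sum, h1]

/-- The weights of the spin representation, shifted by the half-sum of the positive roots of `h`,
are of the form `ρ - ∑_{α ∈ A} α`. -/
theorem exists_spin_weight_eq {h : LieSubalgebra ℂ g} (hB : (complementForm h).Nondegenerate)
    (ht : t ≤ h) (b : (rootSystem t).Base)
    {S : Type*} [AddCommGroup S] [Module ℂ S] [Module (CliffordAlgebra (cliffordForm h)) S]
    [IsScalarTower ℂ (CliffordAlgebra (cliffordForm h)) S] {μ : Module.Dual ℂ t}
    (hμ : IsWeight ht (spinAction h hB S) μ) :
    ∃ A ⊆ posRoots b, μ + rhoSub b h = rho b - ∑ α ∈ A, (rootSystem t).root α := by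
  classical
  obtain ⟨s, hs0, hs⟩ := hμ
  set κ := CliffordAlgebra.ι (cliffordForm h) with hκ
  set Y := complementVector h X with hY
  -- For `X α` in `q`, the Clifford relations say that `κ (Y α)` squares to zero and that `P α + P
  -- (-α) = 1`; hence `P α` is idempotent. Vectors of non-opposite roots anticommute, so the
  -- idempotents commute.
  set P : t.root → CliffordAlgebra (cliffordForm h) := fun α => κ (Y α) * κ (Y (negRoot α)) with hP
  set D := (posRoots b).filter fun α => X α ∉ h with hD
  have hDmem : ∀ {α}, α ∈ D → α ∈ posRoots b ∧ X α ∈ complement h := by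
    intro α hα
    rw [hX.mem_complement_iff hB ht]
    simpa [hD] using hα
  have hanti : ∀ {α β : t.root}, β ≠ negRoot α → κ (Y α) * κ (Y β) = -(κ (Y β) * κ (Y α)) := by
    intro α β hαβ
    rw [eq_neg_iff_add_eq_zero, hκ, ι_mul_ι_add_swap, hX.complementForm_eq_zero h hαβ, map_zero]
  have hself : ∀ {α β : t.root}, β ≠ negRoot α → β ≠ α → negRoot β ≠ α ∧ negRoot β ≠ negRoot α := by
    intro α β h1 h2
    refine ⟨fun h => h1 ?_, fun h => h2 ?_⟩
    · rw [← h, negRoot_negRoot]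
    · rw [← negRoot_negRoot β, h, negRoot_negRoot]
  have hne : ∀ α : t.root, α ≠ negRoot α := by
    intro α hα
    by_cases h1 : α ∈ posRoots b
    · exact negRoot_mem_posRoots.mp (hα ▸ h1) h1
    · exact h1 (hα ▸ negRoot_mem_posRoots.mpr h1)
  have hsq : ∀ α, κ (Y α) * κ (Y α) = 0 := by
    intro α
    have h1 := hanti (hne α)
    rw [eq_neg_iff_add_eq_zero, ← two_smul ℂ, smul_eq_zero] at h1
    exact h1.resolve_left two_ne_zero
  have hadd : ∀ α, X α ∈ complement h → P α + P (negRoot α) = 1 := by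
    intro α hα
    simp only [hP, negRoot_negRoot]
    rw [hκ, ι_mul_ι_add_swap, hX.complementForm_eq_one hB ht hα, map_one]
  have hidem : ∀ α ∈ D, P α * P α = P α := by
    intro α hα
    have h1 := hadd α (hDmem hα).2
    have h2 : P α * P (negRoot α) = 0 := by
      simp only [hP, negRoot_negRoot]
      rw [mul_assoc, ← mul_assoc (κ (Y (negRoot α))), hsq, zero_mul, mul_zero]
    calc P α * P α = P α * (P α + P (negRoot α)) := by rw [mul_add, h2, add_zero]
      _ = P α := by rw [h1, mul_one]
  have hcomm : ∀ α ∈ D, ∀ β ∈ D, Commute (P α) (P β) := by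
    intro α hα β hβ
    by_cases hαβ : β = α
    · rw [hαβ]
    have h1 : β ≠ negRoot α := by
      rintro rfl
      exact negRoot_mem_posRoots.mp (hDmem hβ).1 (hDmem hα).1
    obtain ⟨h2, h3⟩ := hself h1 hαβ
    have a1 := hanti h1
    have a2 : κ (Y α) * κ (Y (negRoot β)) = _ := hanti h3
    have a3 : κ (Y (negRoot α)) * κ (Y β) = _ := hanti (by rwa [negRoot_negRoot])
    have a4 : κ (Y (negRoot α)) * κ (Y (negRoot β)) = _ := hanti (by rwa [negRoot_negRoot])
    change κ (Y α) * κ (Y (negRoot α)) * (κ (Y β) * κ (Y (negRoot β))) =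
      κ (Y β) * κ (Y (negRoot β)) * (κ (Y α) * κ (Y (negRoot α)))
    generalize κ (Y α) = a at *
    generalize κ (Y (negRoot α)) = a' at *
    generalize κ (Y β) = c at *
    generalize κ (Y (negRoot β)) = c' at *
    calc a * a' * (c * c') = a * (a' * c) * c' := by noncomm_ring
      _ = -(a * c * (a' * c')) := by rw [a3]; noncomm_ring
      _ = -(c * (a * c') * a') := by rw [a1, a4]; noncomm_ring
      _ = c * c' * (a * a') := by rw [a2]; noncomm_ring
  -- The roots `α` and `-α` together contribute `α(H) (P α - P (-α))`, which is `α(H) (2 P α - 1)`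
  -- when `X α` lies in `q` and zero when it lies in `h`.
  have hspin : ∀ H : t, spinMap h hB ⟨H, ht H.2⟩ =
      (1 / 2 : ℂ) • ∑ α ∈ D, (rootSystem t).root α H • (2 * P α - 1) := by
    intro H
    rw [hX.spinMap_eq_sum hB ht H, sum_root_eq_sum_posRoots b, hD, Finset.sum_filter]
    congr 1
    refine Finset.sum_congr rfl fun α _ => ?_
    change (rootSystem t).root α H • P α + (rootSystem t).root (negRoot α) H • P (negRoot α) = _
    rw [root_negRoot, LinearMap.neg_apply, neg_smul, ← sub_eq_add_neg, ← smul_sub]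
    by_cases h1 : X α ∉ h
    · rw [if_pos h1]
      have h2 := hadd α ((hX.mem_complement_iff hB ht α).mpr h1)
      congr 1
      rw [← h2, two_mul]
      abel
    · rw [if_neg h1]
      have h2 : X α ∉ complement h := by
        rw [hX.mem_complement_iff hB ht]
        exact h1
      have h3 : Y α = 0 := complementVector_eq_zero h2
      have h4 : P α = 0 := by simp only [hP, h3, map_zero, zero_mul]
      have h5 : P (negRoot α) = 0 := by simp only [hP, negRoot_negRoot, h3, map_zero, mul_zero]
      rw [h4, h5, sub_zero, smul_zero]
  obtain ⟨a, ha, has, haD⟩ := exists_joint_eigenvector P D hidem hcomm hs0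
  set s' := a • s with hs'
  -- The element `a` commutes with whatever commutes with all `P α`, in particular with the image of
  -- `t`, so passing from `s` to `s'` preserves the weight.
  have hspin' : ∀ H : t, spinMap h hB ⟨H, ht H.2⟩ • s' = μ H • s' := by
    intro H
    have hc : Commute (spinMap h hB ⟨H, ht H.2⟩) a := by
      refine ha _ fun β hβ => ?_
      rw [hspin]
      refine Commute.smul_left (Commute.sum_left _ _ _ fun α hα => Commute.smul_left ?_ _) _
      exact ((Nat.cast_commute 2 _).mul_left (hcomm α hα β hβ)).sub_left (Commute.one_left _)
    have h1 : spinMap h hB ⟨H, ht H.2⟩ • s = μ H • s := hs H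
    rw [hs', ← mul_smul, hc.eq, mul_smul, h1, smul_comm]
  have hε : ∀ α, ∃ ε : ℂ, α ∈ D → (ε = 1 ∨ ε = -1) ∧ (2 * P α - 1) • s' = ε • s' := by
    intro α
    by_cases hα : α ∈ D
    · rcases haD α hα with h1 | h1
      · exact ⟨1, fun _ => ⟨Or.inl rfl, by rw [h1, one_smul]⟩⟩
      · exact ⟨-1, fun _ => ⟨Or.inr rfl, by rw [h1, neg_smul, one_smul]⟩⟩
    · exact ⟨1, fun h1 => absurd h1 hα⟩
  choose ε hε using hε
  have hμ : μ = (1 / 2 : ℂ) • ∑ α ∈ D, ε α • (rootSystem t).root α := by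
    ext H
    have h1 := hspin' H
    rw [hspin, smul_assoc, Finset.sum_smul] at h1
    have h2 : ∀ α ∈ D, ((rootSystem t).root α H • (2 * P α - 1)) • s' =
        ((rootSystem t).root α H * ε α) • s' := by
      intro α hα
      rw [smul_assoc, (hε α hα).2, smul_smul]
    rw [Finset.sum_congr rfl h2, ← Finset.sum_smul, smul_smul] at h1
    have h3 := smul_left_injective ℂ has h1
    rw [← h3]
    simp [mul_comm]
  -- Adding `ρ_h` supplies the positive roots in `h` with sign `+`, so only the roots of `D` with
  -- sign `-` must be removed from `ρ`.
  refine ⟨D.filter fun α => ε α = -1, ?_, ?_⟩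
  · exact (Finset.filter_subset _ _).trans (Finset.filter_subset _ _)
  · have hsub : posRootsSub b h = (posRoots b).filter fun α => ¬ X α ∉ h := by
      rw [posRootsSub]
      refine Finset.filter_congr fun α _ => ?_
      rw [hX.rootSpace_le_iff, not_not]
    have hD' : ∑ α ∈ D, (rootSystem t).root α -
        ∑ α ∈ D with ε α = -1, (2 : ℂ) • (rootSystem t).root α = ∑ α ∈ D, ε α • (rootSystem t).root α := by
      rw [Finset.sum_filter (fun α => ε α = -1), ← Finset.sum_sub_distrib]
      refine Finset.sum_congr rfl fun α hα => ?_
      have h1 : ¬ (1 : ℂ) = -1 := by norm_num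
      rcases (hε α hα).1 with h2 | h2
      · rw [h2, if_neg h1]
        module
      · rw [h2, if_pos rfl]
        module
    rw [hμ, ← hD', rho, rhoSub, hsub,
      ← Finset.sum_filter_add_sum_filter_not (posRoots b) (fun α => X α ∉ h), ← hD,
      ← Finset.smul_sum]
    module

end IsDualRootFamily

end RootVectors

/-! ### The inequality and its equality case. -/

section Comparison

variable {g : Type*} [LieRing g] [LieAlgebra ℂ g] [FiniteDimensional ℂ g]
  [LieAlgebra.IsSemisimple ℂ g] {t : LieSubalgebra ℂ g} [t.IsCartanSubalgebra]
  {V : Type*} [AddCommGroup V] [Module ℂ V] [LieRingModule g V] [LieModule ℂ g V]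
  [FiniteDimensional ℂ V] [LieModule.IsIrreducible ℂ g V]

/-- The comparison of norms for a weight `ν` of the irreducible representation of highest weight
`lam` and a signed half-sum `κ` of roots, with the characterization of the case of equality. -/
theorem normSq_diff_of_isDominant {b : (rootSystem t).Base} {lam ν κ : Module.Dual ℂ t}
    (hlam : IsHighestWeight b V lam) (hν : HasWeight V ν) (hκ : IsSignedHalfSum κ) :
    normSq (lam + rho b) - normSq (ν + κ) ≥ normSq (rho b) - normSq κ ∧
    (∃ w : (rootSystem t).weylGroup, IsDominant b (w • ν)) ∧
    ∀ w : (rootSystem t).weylGroup, IsDominant b (w • ν) →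
      (normSq (lam + rho b) - normSq (ν + κ) = normSq (rho b) - normSq κ ↔
        IsExtremal lam ν ∧ form (rho b - w • κ) lam = 0) ∧
      (normSq (lam + rho b) - normSq (ν + κ) = normSq (rho b) - normSq κ →
        ∃ A ⊆ posRoots b, rho b - w • κ = ∑ α ∈ A, (rootSystem t).root α ∧
          ∀ α ∈ A, form ((rootSystem t).root α) lam = 0) := by
  have hdom := hν.isIntegral.exists_isDominant b
  have main : ∀ w : (rootSystem t).weylGroup, IsDominant b (w • ν) →
      ∃ A ⊆ posRoots b, rho b - w • κ = ∑ α ∈ A, (rootSystem t).root α ∧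
      0 ≤ normSq (lam - w • ν) ∧ 0 ≤ form (w • ν) (lam - w • ν) ∧
      0 ≤ form (rho b) (lam - w • ν) ∧ 0 ≤ form (w • ν) (rho b - w • κ) ∧
      (normSq (lam - w • ν) = 0 → lam = w • ν) := by
    intro w hw
    obtain ⟨A, hA, hAκ⟩ := (hκ.smul w).exists_eq_rho_sub b
    have hγ := hlam.sub_mem_posCone (hν.smul w)
    have hint : IsIntegral (lam - w • ν) := by
      have := hlam.hasWeight.isIntegral.add ((hν.smul w).isIntegral.smul (-1))
      simpa [sub_eq_add_neg] using this
    have hσ : rho b - w • κ = ∑ α ∈ A, (rootSystem t).root α := by rw [hAκ, sub_sub_cancel]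
    refine ⟨A, hA, hσ, hint.normSq_nonneg, form_nonneg_of_mem_posCone hw hγ,
      form_nonneg_of_mem_posCone (isDominant_rho b) hγ, ?_,
      fun h0 => sub_eq_zero.mp (hint.eq_zero_of_normSq_eq_zero h0)⟩
    rw [hσ, form_sum_right]
    exact Finset.sum_nonneg fun α hα => hw α (hA hα)
  have hdiff := fun w => normSq_diff_eq b lam ν κ (rho b - w • κ) w (sub_sub_cancel _ _).symm
  have heq : ∀ w : (rootSystem t).weylGroup, IsDominant b (w • ν) →
      normSq (lam + rho b) - normSq (ν + κ) = normSq (rho b) - normSq κ →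
      lam = w • ν ∧ form (w • ν) (rho b - w • κ) = 0 := by
    intro w hw he
    obtain ⟨A, hA, hσ, h1, h2, h3, h4, h5⟩ := main w hw
    have hd := hdiff w
    -- A vanishing sum of four nonnegative terms: the first gives `λ = wν`, the last the
    -- orthogonality.
    rw [he, sub_self, eq_comm, add_eq_zero_iff_of_nonneg (by positivity) (by positivity),
      add_eq_zero_iff_of_nonneg (by positivity) (by positivity),
      add_eq_zero_iff_of_nonneg (by positivity) (by positivity)] at hd
    exact ⟨h5 hd.1.1.1, by simpa using hd.2⟩
  refine ⟨?_, hdom, fun w hw => ⟨⟨fun he => ?_, fun he => ?_⟩, fun he => ?_⟩⟩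
  · obtain ⟨w, hw⟩ := hdom
    obtain ⟨A, hA, hσ, h1, h2, h3, h4, h5⟩ := main w hw
    rw [ge_iff_le, ← sub_nonneg, hdiff w]
    positivity
  · obtain ⟨h1, h2⟩ := heq w hw he
    refine ⟨⟨w⁻¹, by rw [h1, inv_smul_smul]⟩, ?_⟩
    rw [form_comm]
    conv_lhs => rw [h1]
    exact h2
  · obtain ⟨⟨v, hv⟩, h0⟩ := he
    obtain ⟨A, hA, hσ, h1, h2, h3, h4, h5⟩ := main w hw
    -- This sum equals `‖λ‖² - ‖wν‖²`, which is zero for an extremal weight. Both terms being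
    -- nonnegative, the dominant conjugate `wν` is `λ` itself, with no appeal to uniqueness of
    -- dominant representatives.
    have hn : normSq (lam - w • ν) + 2 * form (w • ν) (lam - w • ν) = 0 := by
      have : normSq (w • ν) = normSq lam := by rw [normSq_smul, hv, normSq_smul]
      simp only [normSq, form_sub_left, form_sub_right] at *
      rw [form_comm lam (w • ν)]
      linear_combination -this
    have hl : lam = w • ν := h5 ((add_eq_zero_iff_of_nonneg h1 (by positivity)).mp hn).1
    rw [← sub_eq_zero, hdiff w, hn, ← hl, sub_self, form_comm lam, h0, form_comm, form_zero_left]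
    simp
  · obtain ⟨h1, h2⟩ := heq w hw he
    obtain ⟨A, hA, hσ, -⟩ := main w hw
    refine ⟨A, hA, hσ, fun α hα => ?_⟩
    rw [hσ, form_sum_right, Finset.sum_eq_zero_iff_of_nonneg fun α hα => hw α (hA hα)] at h2
    rw [form_comm, h1]
    exact h2 α hα

end Comparison

end DiracPair

end

theorem theorem3p3 {g : Type*} [LieRing g] [LieAlgebra ℂ g] [FiniteDimensional ℂ g]
    [LieAlgebra.IsSemisimple ℂ g]
    (h t : LieSubalgebra ℂ g) [LieAlgebra.HasCentralRadical ℂ h] [t.IsCartanSubalgebra]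
    (ht : t ≤ h) (b : (LieAlgebra.IsKilling.rootSystem t).Base)
    (V : Type*) [AddCommGroup V] [Module ℂ V] [LieRingModule g V] [LieModule ℂ g V]
    [FiniteDimensional ℂ V] [LieModule.IsIrreducible ℂ g V]
    (lam : Module.Dual ℂ t) (hlam : DiracPair.IsHighestWeight b V lam)
    (S : Type*) [AddCommGroup S] [Module ℂ S]
    [Module (CliffordAlgebra (DiracPair.cliffordForm h)) S]
    [IsScalarTower ℂ (CliffordAlgebra (DiracPair.cliffordForm h)) S]
    [IsSimpleModule (CliffordAlgebra (DiracPair.cliffordForm h)) S]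
    (μ μ₁ : Module.Dual ℂ t)
    (hμ : DiracPair.IsWeight ht
      (DiracPair.tensorAction (DiracPair.restrictAction h V)
        (DiracPair.spinAction h (DiracPair.complementForm_nondegenerate h t ht) S)) μ)
    (hμ₁ : DiracPair.IsRelated ht (DiracPair.restrictAction h V)
      (DiracPair.spinAction h (DiracPair.complementForm_nondegenerate h t ht) S) μ μ₁) :
    DiracPair.normSq (lam + DiracPair.rho b) - DiracPair.normSq (μ + DiracPair.rhoSub b h) ≥
        DiracPair.normSq (DiracPair.rho b) - DiracPair.normSq (μ₁ + DiracPair.rhoSub b h) ∧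
    (∃ w : (LieAlgebra.IsKilling.rootSystem t).weylGroup,
      DiracPair.IsDominant b (w • (μ - μ₁))) ∧
    ∀ w : (LieAlgebra.IsKilling.rootSystem t).weylGroup,
      DiracPair.IsDominant b (w • (μ - μ₁)) →
      (DiracPair.normSq (lam + DiracPair.rho b) - DiracPair.normSq (μ + DiracPair.rhoSub b h) =
          DiracPair.normSq (DiracPair.rho b) - DiracPair.normSq (μ₁ + DiracPair.rhoSub b h) ↔
        DiracPair.IsExtremal lam (μ - μ₁) ∧
          DiracPair.form (DiracPair.rho b - w • (μ₁ + DiracPair.rhoSub b h)) lam = 0) ∧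
      (DiracPair.normSq (lam + DiracPair.rho b) - DiracPair.normSq (μ + DiracPair.rhoSub b h) =
          DiracPair.normSq (DiracPair.rho b) - DiracPair.normSq (μ₁ + DiracPair.rhoSub b h) →
        ∃ A ⊆ DiracPair.posRoots b,
          DiracPair.rho b - w • (μ₁ + DiracPair.rhoSub b h) =
            ∑ α ∈ A, (LieAlgebra.IsKilling.rootSystem t).root α ∧
          ∀ α ∈ A, DiracPair.form ((LieAlgebra.IsKilling.rootSystem t).root α) lam = 0) := by
  obtain ⟨X, hX⟩ := DiracPair.exists_isDualRootFamily b
  obtain ⟨B, hB, hκ⟩ := hX.exists_spin_weight_eq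
    (DiracPair.complementForm_nondegenerate h t ht) ht b hμ₁.1
  have hν : DiracPair.HasWeight V (μ - μ₁) := hμ₁.2
  -- The comparison is applied with `ν = μ - μ₁` and `κ = μ₁ + ρ_h`.
  have hsum : μ + DiracPair.rhoSub b h = μ - μ₁ + (μ₁ + DiracPair.rhoSub b h) := by abel
  rw [hsum]
  refine DiracPair.normSq_diff_of_isDominant hlam hν ?_
  rw [hκ]
  exact DiracPair.isSignedHalfSum_rho_sub b hB
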